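/- Let $\mathbf{k}$ be an algebraically closed field, let $r\ge 1$, and let $F_k$ be the free group on $k$ generators. For a group $\Gamma$, the character variety $X(\Gamma,\mathrm{SL}_r)$ is the set of all characters $\chi_\rho:\Gamma\to\mathbf{k}$, $\chi_\rho(g)=\operatorname{tr}\rho(g)$, of representations $\rho:\Gamma\to\mathrm{SL}_r(\mathbf{k})$, with the Zariski topology, in which the closed sets are those cut out by polynomials in the trace coordinates $\chi\mapsto\chi(g)$, $g\in\Gamma$; $\dim$ denotes its (Krull) dimension as a topological space, i.e. the supremum of the lengths of chains of irreducible closed subsets. Then $$\dim X(F_k,\mathrm{SL}_r)=(r^2-1)(k-1)\quad\text{for every } k\ge 2,$$ and $$\dim X(F_1,\mathrm{SL}_r)=r-1.$$ -/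

import Mathlib

open Topology

namespace CharVar

/-- The subset of affine space `𝕜 ^ ι` cut out by a set `S` of polynomials (the index set `ι` may
be infinite). -/
def zeroSet {𝕜 ι : Type*} [Field 𝕜] (S : Set (MvPolynomial ι 𝕜)) : Set (ι → 𝕜) :=
  {x | ∀ p ∈ S, MvPolynomial.eval x p = 0}

/-- The Zariski topology on affine space `𝕜 ^ ι`: the closed sets are exactly the zero sets of
sets of polynomials. -/
@[reducible]
def zariskiTopology (𝕜 ι : Type*) [Field 𝕜] : TopologicalSpace (ι → 𝕜) :=
  TopologicalSpace.ofClosed (Set.range (zeroSet : Set (MvPolynomial ι 𝕜) → Set (ι → 𝕜)))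
    ⟨{1}, by ext x; simp [zeroSet]⟩
    (by
      intro A hA
      refine ⟨{p | ∃ S, zeroSet S ∈ A ∧ p ∈ S}, ?_⟩
      ext x
      simp only [zeroSet, Set.mem_ofPred_eq, Set.mem_sInter]
      constructor
      · intro h t ht
        obtain ⟨S, rfl⟩ := hA ht
        exact fun p hp => h p ⟨S, ht, hp⟩
      · rintro h p ⟨S, hS, hp⟩
        exact h _ hS p hp)
    (by
      rintro _ ⟨S, rfl⟩ _ ⟨T, rfl⟩
      refine ⟨{p | ∃ a ∈ S, ∃ b ∈ T, p = a * b}, ?_⟩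
      ext x
      simp only [zeroSet, Set.mem_ofPred_eq, Set.mem_union]
      constructor
      · intro h
        by_contra! hc
        obtain ⟨⟨a, ha, ha'⟩, b, hb, hb'⟩ := hc
        have := h (a * b) ⟨a, ha, b, hb, rfl⟩
        rw [map_mul] at this
        exact (mul_ne_zero ha' hb') this
      · rintro (h | h) p ⟨a, ha, b, hb, rfl⟩
        · rw [map_mul, h a ha, zero_mul]
        · rw [map_mul, h b hb, mul_zero])

theorem isClosed_zariskiTopology_iff {𝕜 ι : Type*} [Field 𝕜] {C : Set (ι → 𝕜)} :
    IsClosed[zariskiTopology 𝕜 ι] C ↔ ∃ S : Set (MvPolynomial ι 𝕜), zeroSet S = C := by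
  rw [← @isOpen_compl_iff _ _ (zariskiTopology 𝕜 ι)]
  change Cᶜᶜ ∈ Set.range _ ↔ _
  rw [compl_compl]
  rfl

/-- The character `g ↦ tr (ρ g)` of a representation `ρ : Γ → SL_r(𝕜)`. -/
def character {𝕜 Γ : Type*} [Field 𝕜] [Group Γ] {r : ℕ}
    (ρ : Γ →* Matrix.SpecialLinearGroup (Fin r) 𝕜) : Γ → 𝕜 :=
  fun g => Matrix.trace (ρ g : Matrix (Fin r) (Fin r) 𝕜)

/-- The character variety `X(Γ, SL_r)` over `𝕜`: the image in `𝕜 ^ Γ` of the representation space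
`Hom(Γ, SL_r(𝕜))` under the character map. -/
def CharacterVariety (𝕜 Γ : Type*) [Field 𝕜] [Group Γ] (r : ℕ) : Type _ :=
  {c : Γ → 𝕜 // ∃ ρ : Γ →* Matrix.SpecialLinearGroup (Fin r) 𝕜, character ρ = c}

/-- The Zariski topology of the character variety: a subset is closed when it is cut out by
polynomials in the trace coordinates `χ ↦ χ g`, for `g` in `Γ`. For `g₁, …, g_a` whose trace
functions generate the algebra of all trace functions, this is the topology of the image of the
character variety in `𝕜 ^ a` under `χ ↦ (χ g₁, …, χ g_a)`. -/
instance instTopologicalSpaceCharacterVariety (𝕜 Γ : Type*) [Field 𝕜] [Group Γ] (r : ℕ) :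
    TopologicalSpace (CharacterVariety 𝕜 Γ r) :=
  TopologicalSpace.induced Subtype.val (zariskiTopology 𝕜 Γ)

end CharVar

/-! Both bounds are parameter counts, with `r = n + 1`. Up to conjugation the first matrix of a
generic tuple has `n` parameters, the second `(n + 1) * n`, and each further one `r ^ 2 - 1`. The
first two together give `r ^ 2 - 1`, whence `(r ^ 2 - 1) * (k - 1)`; for `k = 1` only `n` remains.

Upper bound: over an algebraically closed field every character comes from a tuple whose second
matrix has `e₀` as an eigenvector. For the generic such tuple, conjugation by the Krylov matrix of
the first matrix, which fixes `e₀`, turns that matrix into a companion matrix and keeps the zeros of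
the second. Traces do not change, so they are polynomials in the remaining entries, and each
condition `det = 1` costs one parameter (`eRk_entries_lt`). A chain of irreducible closed sets is no
longer than the transcendence degree of the generic character (`topologicalKrullDim_le`).

Lower bound: a slice with equally many free coordinates is chosen on which traces determine the
coordinates up to algebraic dependence (`isAlgebraic_slice`). The power sums of the diagonal first
matrix make its entries algebraic over the traces, interpolation yields the diagonal idempotents,
and these isolate single matrix entries. Chains of primes in the coordinate ring of the slice then
stay strict on the trace algebra (`le_topologicalKrullDim`). -/

namespace CharVar

/-! ### Chains of primes and algebraic independence -/

theorem exists_algebraicIndependent_of_ltSeries (k : Type*) {S : Type*} [Field k] [CommRing S]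
    [Algebra k S] (l : LTSeries (PrimeSpectrum S)) :
    ∃ x : Fin l.length → S,
      AlgebraicIndependent k fun i => Ideal.Quotient.mk l.head.asIdeal (x i) := by
  induction l using RelSeries.inductionOn with
  | singleton q =>
    refine ⟨fun _ => 0, ?_⟩
    have : IsEmpty (Fin (RelSeries.singleton
      {(a, b) : PrimeSpectrum S × PrimeSpectrum S | a < b} q).length) :=
      inferInstanceAs (IsEmpty (Fin 0))
    rw [algebraicIndependent_empty_type_iff]
    exact FaithfulSMul.algebraMap_injective k _
  | cons l q lt ih =>
    obtain ⟨x, hx⟩ := ih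
    have hlt : q.asIdeal < l.head.asIdeal := lt
    obtain ⟨a, ha, haq⟩ := SetLike.exists_of_lt hlt
    let π : (S ⧸ q.asIdeal) →ₐ[k] (S ⧸ l.head.asIdeal) := Ideal.Quotient.factorₐ k hlt.le
    have hy : AlgebraicIndependent k (fun i => Ideal.Quotient.mk q.asIdeal (x i)) :=
      AlgebraicIndependent.of_comp π hx
    -- If `a` were algebraic mod `q`, it would divide a nonzero polynomial in the `x i`. That
    -- polynomial dies in the quotient by the larger prime, where the `x i` are still independent.
    have htr : Transcendental
        (Algebra.adjoin k (Set.range fun i => Ideal.Quotient.mk q.asIdeal (x i)))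
        (Ideal.Quotient.mk q.asIdeal a) := by
      intro halg
      obtain ⟨⟨r, hr⟩, hr0, b, hb⟩ := halg.exists_nonzero_dvd
        (mem_nonZeroDivisors_of_ne_zero fun h => haq (Ideal.Quotient.eq_zero_iff_mem.1 h))
      have hb' : r = Ideal.Quotient.mk q.asIdeal a * b := hb
      have hπ : π r = 0 := by
        rw [hb', map_mul]
        have : π (Ideal.Quotient.mk q.asIdeal a) = 0 := Ideal.Quotient.eq_zero_iff_mem.2 ha
        rw [this, zero_mul]
      rw [Algebra.adjoin_range_eq_range_aeval] at hr
      obtain ⟨G, rfl⟩ := hr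
      rw [AlgHom.toRingHom_eq_coe, RingHom.coe_coe, MvPolynomial.comp_aeval_apply] at hπ
      have hG : G = 0 := hx (by rw [map_zero]; exact hπ)
      exact hr0 (Subtype.ext (by simp [hG]))
    have h := (hy.option_iff_transcendental _).2 htr
    have e : Fin (l.cons q lt).length ≃ Option (Fin l.length) :=
      Fintype.equivOfCardEq (by simp)
    refine ⟨fun i => (e i).elim a x, ?_⟩
    rw [RelSeries.head_cons]
    convert h.comp e e.injective using 1
    funext i
    simp only [Function.comp_apply]
    cases e i <;> rfl

/-- Noether normalization makes `A` integral over a polynomial ring in `s` variables. Integrality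
preserves transcendence degree, so `N ≤ s`, and going-up lifts a chain of length `s`. -/
theorem le_ringKrullDim_of_algebraicIndependent {k A : Type*} [Field k] [CommRing A] [IsDomain A]
    [Algebra k A] [Algebra.FiniteType k A] {N : ℕ} {y : Fin N → A} (hy : AlgebraicIndependent k y) :
    (N : WithBot ℕ∞) ≤ ringKrullDim A := by
  obtain ⟨s, g, hg, hgi⟩ := exists_integral_inj_algHom_of_fg k A
  algebraize [g.toRingHom]
  have hT : IsScalarTower k (MvPolynomial (Fin s) k) A :=
    IsScalarTower.of_algebraMap_eq fun x => (g.commutes x).symm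
  have hint : Algebra.IsIntegral (MvPolynomial (Fin s) k) A := ⟨hgi⟩
  have hf : FaithfulSMul (MvPolynomial (Fin s) k) A :=
    (faithfulSMul_iff_algebraMap_injective _ _).2 hg
  have htr := lift_trdeg_add_eq k (MvPolynomial (Fin s) k) A
  have hN := hy.lift_cardinalMk_le_trdeg
  have hNs : N ≤ s := by
    rw [trdeg_eq_zero (R := MvPolynomial (Fin s) k) (A := A), MvPolynomial.trdeg_of_isDomain] at htr
    simp only [Cardinal.mk_fin, Cardinal.lift_natCast, Cardinal.lift_zero, add_zero] at htr hN
    rw [Cardinal.lift_uzero] at hN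
    have h2 := Cardinal.lift_le.{_, _}.2 hN
    rw [← htr] at h2
    simpa using h2
  have hd : ((s : ℕ) : WithBot ℕ∞) ≤ ringKrullDim (MvPolynomial (Fin s) k) := by
    rw [MvPolynomial.ringKrullDim_of_isNoetherianRing]; simp
  obtain ⟨l, hl⟩ := Order.le_krullDim_iff.1 hd
  obtain ⟨Q, hQ, hQl⟩ := Ideal.exists_ideal_over_prime_of_isIntegral_of_isDomain (S := A)
    l.head.asIdeal
    (by rw [(RingHom.injective_iff_ker_eq_bot _).1
          (FaithfulSMul.algebraMap_injective (MvPolynomial (Fin s) k) A)]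
        exact bot_le)
  have : Q.LiesOver l.head.asIdeal := ⟨hQl.symm⟩
  obtain ⟨L, hL, -⟩ := Ideal.exists_ltSeries_of_hasGoingUp l Q
  refine le_trans ?_ (Order.le_krullDim_iff.2 ⟨L, hL.trans hl⟩)
  exact_mod_cast hNs

/-- A chain of primes of length `N` in a finitely generated domain, strict after contraction to a
subalgebra over which the domain is algebraic. -/
theorem exists_ltSeries_comap_strict {k A : Type*} [Field k] [CommRing A] [IsDomain A]
    [Algebra k A] [Algebra.FiniteType k A] (R : Subalgebra k A) [Algebra.IsAlgebraic R A]
    {N : ℕ} {y : Fin N → A} (hy : AlgebraicIndependent k y) :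
    ∃ l : LTSeries (PrimeSpectrum A), l.length = N ∧
      ∀ i j, i < j → ∃ x ∈ (l j).asIdeal, x ∈ R ∧ x ∉ (l i).asIdeal := by
  obtain ⟨s, hs⟩ := (Algebra.FiniteType.out : (⊤ : Subalgebra k A).FG)
  -- `h` is a common denominator: each generator, hence each element, becomes integral over `R`
  -- after multiplication by a power of `h`. The chain is taken in `A[1/h]`, so that its primes
  -- avoid `h`.
  obtain ⟨h, hh, hint⟩ := Algebra.IsAlgebraic.exists_integral_multiples R s
  have hh' : (h : A) ≠ 0 := fun h0 => hh (Subtype.ext h0)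
  have hall : ∀ x : A, ∃ n : ℕ, IsIntegral R ((h : A) ^ n * x) := by
    have hI : IsIntegral R (h : A) := isIntegral_algebraMap (x := h)
    intro x
    have hx : x ∈ Algebra.adjoin k (s : Set A) := hs ▸ Algebra.mem_top
    induction hx using Algebra.adjoin_induction with
    | mem x hx => exact ⟨1, by simpa [Subalgebra.smul_def] using hint x hx⟩
    | algebraMap r =>
      refine ⟨0, ?_⟩
      rw [pow_zero, one_mul]
      exact isIntegral_algebraMap (x := algebraMap k R r)
    | add x y _ _ hx hy =>
      obtain ⟨m, hm⟩ := hx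
      obtain ⟨n, hn⟩ := hy
      refine ⟨m + n, ?_⟩
      convert ((hI.pow n).mul hm).add ((hI.pow m).mul hn) using 1
      ring
    | mul x y _ _ hx hy =>
      obtain ⟨m, hm⟩ := hx
      obtain ⟨n, hn⟩ := hy
      refine ⟨m + n, ?_⟩
      convert hm.mul hn using 1
      ring
  have hpow : Submonoid.powers (h : A) ≤ nonZeroDivisors A :=
    powers_le_nonZeroDivisors_of_noZeroDivisors hh'
  have := IsLocalization.isDomain_localization hpow
  have hft : Algebra.FiniteType k (Localization.Away (h : A)) :=
    Algebra.FiniteType.trans (S := A) inferInstance inferInstance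
  have hinj : Function.Injective (IsScalarTower.toAlgHom k A (Localization.Away (h : A))) :=
    IsLocalization.injective _ hpow
  obtain ⟨L, hL⟩ := Order.le_krullDim_iff.1
    (le_ringKrullDim_of_algebraicIndependent (hy.map' hinj))
  refine ⟨L.map (PrimeSpectrum.comap (algebraMap A (Localization.Away (h : A)))) ?_, hL, ?_⟩
  · intro p q hpq
    exact (IsLocalization.orderEmbedding (Submonoid.powers (h : A)) _).strictMono hpq
  · intro i j hij
    have hlt : ((L i).asIdeal.comap (algebraMap A (Localization.Away (h : A)))) <
        ((L j).asIdeal.comap (algebraMap A (Localization.Away (h : A)))) :=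
      (IsLocalization.orderEmbedding (Submonoid.powers (h : A)) _).strictMono
        (L.strictMono hij)
    obtain ⟨x, hxj, hxi⟩ := SetLike.exists_of_lt hlt
    obtain ⟨n, hn⟩ := hall x
    have hu : ∀ p : PrimeSpectrum (Localization.Away (h : A)),
        (h : A) ∉ p.asIdeal.comap (algebraMap A (Localization.Away (h : A))) := fun p hp =>
      p.2.ne_top (Ideal.eq_top_of_isUnit_mem _ hp (IsLocalization.Away.algebraMap_isUnit (h : A)))
    -- Incomparability: `h ^ n * x` is integral over `R` and still separates the two primes.
    have := Ideal.comap_lt_comap_of_integral_mem_sdiff hlt.le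
      ⟨Ideal.mul_mem_left _ ((h : A) ^ n) hxj, fun hm =>
        ((Ideal.IsPrime.mem_or_mem inferInstance hm).elim
          (fun h1 => hu _ (Ideal.IsPrime.mem_of_pow_mem inferInstance _ h1)) hxi)⟩ hn
    obtain ⟨z, hzj, hzi⟩ := SetLike.exists_of_lt this
    exact ⟨z, hzj, z.2, hzi⟩

/-! ### Irreducible closed sets of characters and the two dimension criteria -/

variable {𝕜 Γ : Type*} [Field 𝕜] [Group Γ] {r : ℕ}

theorem isClosed_characterVariety_iff {C : Set (CharacterVariety 𝕜 Γ r)} :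
    IsClosed C ↔ ∃ S : Set (MvPolynomial Γ 𝕜), C = {χ | ∀ p ∈ S, MvPolynomial.eval χ.1 p = 0} := by
  rw [@isClosed_induced_iff _ _ (zariskiTopology 𝕜 Γ)]
  constructor
  · rintro ⟨t, ht, rfl⟩
    obtain ⟨S, rfl⟩ := isClosed_zariskiTopology_iff.1 ht
    exact ⟨S, rfl⟩
  · rintro ⟨S, rfl⟩
    exact ⟨_, isClosed_zariskiTopology_iff.2 ⟨S, rfl⟩, rfl⟩

/-- The ideal of polynomials in the trace coordinates vanishing on a set of characters. -/
def vanishing (Z : Set (CharacterVariety 𝕜 Γ r)) : Ideal (MvPolynomial Γ 𝕜) where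
  carrier := {p | ∀ χ ∈ Z, MvPolynomial.eval χ.1 p = 0}
  add_mem' ha hb χ hχ := by rw [map_add, ha χ hχ, hb χ hχ, add_zero]
  zero_mem' χ _ := map_zero _
  smul_mem' a b hb χ hχ := by rw [smul_eq_mul, map_mul, hb χ hχ, mul_zero]

theorem eq_of_isClosed_vanishing {Z : Set (CharacterVariety 𝕜 Γ r)} (hZ : IsClosed Z) :
    {χ | ∀ p ∈ vanishing Z, MvPolynomial.eval χ.1 p = 0} = Z := by
  obtain ⟨S, rfl⟩ := isClosed_characterVariety_iff.1 hZ
  exact Set.Subset.antisymm (fun χ hχ p hp => hχ p fun ψ hψ => hψ p hp)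
    fun χ hχ p hp => hp χ hχ

theorem vanishing_isPrime (Z : TopologicalSpace.IrreducibleCloseds (CharacterVariety 𝕜 Γ r)) :
    (vanishing (Z : Set (CharacterVariety 𝕜 Γ r))).IsPrime := by
  obtain ⟨χ₀, hχ₀⟩ := Z.isIrreducible.nonempty
  refine ⟨fun h => ?_, fun {p q} hpq => ?_⟩
  · have : (1 : MvPolynomial Γ 𝕜) ∈ vanishing (Z : Set (CharacterVariety 𝕜 Γ r)) := by
      rw [h]; trivial
    have h1 := this χ₀ hχ₀
    rw [map_one] at h1
    exact one_ne_zero h1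
  · have hcl : ∀ p : MvPolynomial Γ 𝕜,
        IsClosed {χ : CharacterVariety 𝕜 Γ r | MvPolynomial.eval χ.1 p = 0} := fun p =>
      isClosed_characterVariety_iff.2 ⟨{p}, by simp⟩
    refine (isPreirreducible_iff_isClosed_union_isClosed.1 Z.isIrreducible.isPreirreducible _ _
      (hcl p) (hcl q) fun χ hχ => ?_)
    have h1 := hpq χ hχ
    rw [map_mul] at h1
    exact mul_eq_zero.1 h1

/-- Here `c` is a generic character: relations among its values hold for all characters. Vanishing
ideals turn a chain of closed sets into a chain of primes; elements independent modulo the smallest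
prime stay independent when evaluated at `c`, because that prime contains the kernel of the
evaluation. -/
theorem topologicalKrullDim_le {K : Type*} [Field K] [Algebra 𝕜 K] (c : Γ → K)
    (hc : ∀ p : MvPolynomial Γ 𝕜, MvPolynomial.aeval c p = 0 →
      ∀ χ : CharacterVariety 𝕜 Γ r, MvPolynomial.eval χ.1 p = 0) {N : ℕ}
    (hN : (AlgebraicIndependent.matroid 𝕜 K).eRk (Set.range c) ≤ N) :
    topologicalKrullDim (CharacterVariety 𝕜 Γ r) ≤ N := by
  refine iSup_le fun l => ?_
  let f : TopologicalSpace.IrreducibleCloseds (CharacterVariety 𝕜 Γ r) →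
      (PrimeSpectrum (MvPolynomial Γ 𝕜))ᵒᵈ := fun Z => OrderDual.toDual ⟨_, vanishing_isPrime Z⟩
  have hf : StrictMono f := by
    intro Z W hZW
    refine lt_of_le_not_ge (fun p hp χ hχ => hp χ (hZW.le hχ)) fun hle => hZW.not_ge fun χ hχ => ?_
    change χ ∈ (Z : Set (CharacterVariety 𝕜 Γ r))
    rw [← eq_of_isClosed_vanishing Z.isClosed]
    exact fun p hp => hle hp χ hχ
  let L : LTSeries (PrimeSpectrum (MvPolynomial Γ 𝕜)) :=
    LTSeries.mk l.length (fun i => OrderDual.ofDual (f (l i.rev)))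
      fun i j hij => hf (l.strictMono (Fin.rev_lt_rev.2 hij))
  have hL : L.length = l.length := rfl
  obtain ⟨x, hx⟩ := exists_algebraicIndependent_of_ltSeries 𝕜 L
  obtain ⟨Z, hZ⟩ : ∃ Z : TopologicalSpace.IrreducibleCloseds (CharacterVariety 𝕜 Γ r),
      L.head = OrderDual.ofDual (f Z) := ⟨_, rfl⟩
  have hy : AlgebraicIndependent 𝕜 fun i => MvPolynomial.aeval c (x i) := by
    rw [algebraicIndependent_iff]
    intro G hG
    rw [← MvPolynomial.comp_aeval_apply] at hG
    refine algebraicIndependent_iff.1 hx G ?_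
    have := MvPolynomial.comp_aeval_apply (Ideal.Quotient.mkₐ 𝕜 L.head.asIdeal) (f := x) G
    refine this.symm.trans (Ideal.Quotient.eq_zero_iff_mem.2 ?_)
    rw [hZ]
    exact fun χ _ => hc _ hG χ
  have hind : (AlgebraicIndependent.matroid 𝕜 K).Indep
      (Set.range fun i => MvPolynomial.aeval c (x i)) :=
    AlgebraicIndependent.matroid_indep_iff.2 hy.to_subtype_range
  have hsub : (Set.range fun i => MvPolynomial.aeval c (x i)) ⊆
      (AlgebraicIndependent.matroid 𝕜 K).closure (Set.range c) := by
    rw [AlgebraicIndependent.matroid_closure_eq]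
    rintro _ ⟨i, rfl⟩
    have : MvPolynomial.aeval c (x i) ∈ Algebra.adjoin 𝕜 (Set.range c) := by
      rw [Algebra.adjoin_range_eq_range_aeval]; exact ⟨_, rfl⟩
    exact isAlgebraic_algebraMap (⟨_, this⟩ : Algebra.adjoin 𝕜 (Set.range c))
  have h1 := (hind.encard_le_eRk_of_subset hsub).trans
    ((Matroid.eRk_closure_eq _ _).le.trans hN)
  rw [← Set.image_univ, hy.injective.encard_image, Set.encard_univ, ENat.card_eq_coe_fintype_card,
    Fintype.card_fin, hL] at h1
  exact_mod_cast h1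

/-- Nullstellensatz: `A` is Jacobson, so some maximal ideal above `q` avoids `a`, and its residue
field maps to `𝕜`. -/
theorem exists_algHom_apply_ne_zero [IsAlgClosed 𝕜] {A : Type*} [CommRing A] [Algebra 𝕜 A]
    [Algebra.FiniteType 𝕜 A] (q : Ideal A) [q.IsPrime] {a : A} (ha : a ∉ q) :
    ∃ φ : A →ₐ[𝕜] 𝕜, (∀ x ∈ q, φ x = 0) ∧ φ a ≠ 0 := by
  have hJ : IsJacobsonRing A := isJacobsonRing_of_finiteType (A := 𝕜)
  have hq : q.jacobson = q := hJ.out (Ideal.IsPrime.isRadical inferInstance)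
  rw [← hq, Ideal.jacobson, Submodule.mem_sInf] at ha
  push Not at ha
  obtain ⟨m, ⟨hqm, hm⟩, ham⟩ := ha
  let : Field (A ⧸ m) := Ideal.Quotient.field m
  have := finite_of_finite_type_of_isJacobsonRing 𝕜 (A ⧸ m)
  let ψ : (A ⧸ m) →ₐ[𝕜] 𝕜 := IsAlgClosed.lift
  refine ⟨ψ.comp (Ideal.Quotient.mkₐ 𝕜 m), fun x hx => ?_, ?_⟩
  · have : Ideal.Quotient.mkₐ 𝕜 m x = 0 := Ideal.Quotient.eq_zero_iff_mem.2 (hqm hx)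
    rw [AlgHom.comp_apply, this, map_zero]
  · rw [AlgHom.comp_apply, Ne, map_eq_zero]
    exact fun h => ham (Ideal.Quotient.eq_zero_iff_mem.1 h)

/-- A prime `q` of `A` yields the zero set `C q` of its contraction to polynomials in the traces. By
the Nullstellensatz no further polynomial vanishes on `C q` (`hC`), so `C q` is irreducible and
strict contractions give strict inclusions. -/
theorem le_topologicalKrullDim [IsAlgClosed 𝕜] {A : Type*} [CommRing A] [IsDomain A]
    [Algebra 𝕜 A] [Algebra.FiniteType 𝕜 A] (c : Γ → A)
    (hc : ∀ φ : A →ₐ[𝕜] 𝕜, ∃ χ : CharacterVariety 𝕜 Γ r, χ.1 = fun g => φ (c g))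
    [Algebra.IsAlgebraic (Algebra.adjoin 𝕜 (Set.range c)) A]
    {N : ℕ} {y : Fin N → A} (hy : AlgebraicIndependent 𝕜 y) :
    (N : WithBot ℕ∞) ≤ topologicalKrullDim (CharacterVariety 𝕜 Γ r) := by
  have heval : ∀ (φ : A →ₐ[𝕜] 𝕜) (χ : CharacterVariety 𝕜 Γ r), (χ.1 = fun g => φ (c g)) →
      ∀ p, MvPolynomial.eval χ.1 p = φ (MvPolynomial.aeval c p) := by
    intro φ χ h p
    rw [MvPolynomial.comp_aeval_apply, h, MvPolynomial.aeval_eq_eval]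
  let C : PrimeSpectrum A → Set (CharacterVariety 𝕜 Γ r) := fun q =>
    {χ | ∀ p, MvPolynomial.aeval c p ∈ q.asIdeal → MvPolynomial.eval χ.1 p = 0}
  have hC : ∀ (q : PrimeSpectrum A) (p : MvPolynomial Γ 𝕜), MvPolynomial.aeval c p ∉ q.asIdeal →
      ∃ χ ∈ C q, MvPolynomial.eval χ.1 p ≠ 0 := by
    intro q p hp
    obtain ⟨φ, hφ, hφp⟩ := exists_algHom_apply_ne_zero (𝕜 := 𝕜) q.asIdeal hp
    obtain ⟨χ, hχ⟩ := hc φ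
    refine ⟨χ, fun p' hp' => ?_, ?_⟩
    · rw [heval φ χ hχ]; exact hφ _ hp'
    · rwa [heval φ χ hχ]
  have hclosed : ∀ q, IsClosed (C q) := fun q =>
    isClosed_characterVariety_iff.2 ⟨{p | MvPolynomial.aeval c p ∈ q.asIdeal}, rfl⟩
  have hirr : ∀ q, IsIrreducible (C q) := by
    intro q
    constructor
    · obtain ⟨χ, hχ, -⟩ := hC q 1 (by
        rw [map_one]; exact fun h => q.2.ne_top ((Ideal.eq_top_iff_one _).2 h))
      exact ⟨χ, hχ⟩
    · rw [isPreirreducible_iff_isClosed_union_isClosed]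
      intro Z₁ Z₂ h₁ h₂ hsub
      obtain ⟨S₁, rfl⟩ := isClosed_characterVariety_iff.1 h₁
      obtain ⟨S₂, rfl⟩ := isClosed_characterVariety_iff.1 h₂
      by_contra! hcon
      obtain ⟨hn₁, hn₂⟩ := hcon
      obtain ⟨χ₁, hχ₁, hχ₁'⟩ := Set.not_subset.1 hn₁
      obtain ⟨χ₂, hχ₂, hχ₂'⟩ := Set.not_subset.1 hn₂
      simp only [Set.mem_ofPred_eq, not_forall] at hχ₁' hχ₂'
      obtain ⟨p₁, hp₁, hv₁⟩ := hχ₁'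
      obtain ⟨p₂, hp₂, hv₂⟩ := hχ₂'
      obtain ⟨χ, hχ, hχ'⟩ := hC q (p₁ * p₂) (by
        rw [map_mul]
        intro h
        exact (q.2.mem_or_mem h).elim (fun h => hv₁ (hχ₁ _ h)) fun h => hv₂ (hχ₂ _ h))
      rw [map_mul] at hχ'
      rcases hsub hχ with h | h
      · exact hχ' (by rw [h p₁ hp₁, zero_mul])
      · exact hχ' (by rw [h p₂ hp₂, mul_zero])
  obtain ⟨l, hl, hstrict⟩ :=
    exists_ltSeries_comap_strict (Algebra.adjoin 𝕜 (Set.range c)) hy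
  let Z : PrimeSpectrum A → TopologicalSpace.IrreducibleCloseds (CharacterVariety 𝕜 Γ r) :=
    fun q => ⟨C q, hirr q, hclosed q⟩
  let L : LTSeries (TopologicalSpace.IrreducibleCloseds (CharacterVariety 𝕜 Γ r))ᵒᵈ :=
    LTSeries.mk l.length (fun i => OrderDual.toDual (Z (l i))) (by
      intro i j hij
      change Z (l j) < Z (l i)
      refine lt_of_le_not_ge (fun χ hχ p hp => hχ p (l.monotone hij.le hp)) fun hle => ?_
      obtain ⟨x, hxj, hx, hxi⟩ := hstrict i j hij
      rw [Algebra.adjoin_range_eq_range_aeval] at hx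
      obtain ⟨p, rfl⟩ := hx
      obtain ⟨χ, hχ, hχ'⟩ := hC (l i) p hxi
      exact hχ' (hle hχ p hxj))
  rw [topologicalKrullDim, ← Order.krullDim_orderDual]
  exact Order.le_krullDim_iff.2 ⟨L, hl⟩

/-! ### Generic representations of the free group -/

section Generic

variable {𝕜 σ : Type*} [Field 𝕜] {k r : ℕ}

/-- Scaling one row of a matrix by the inverse of its determinant. -/
def rowScale {R : Type*} [CommRing R] (i : Fin r) (M : Matrix (Fin r) (Fin r) R) (d : R)
    (h : d * M.det = 1) : Matrix.SpecialLinearGroup (Fin r) R :=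
  ⟨M.updateRow i (d • M i), by
    rw [Matrix.det_updateRow_smul, Matrix.updateRow_eq_self, h]⟩

/-- The localization of a polynomial ring in which given square matrices become invertible. -/
abbrev CoordRing (M : Fin k → Matrix (Fin r) (Fin r) (MvPolynomial σ 𝕜)) : Type _ :=
  Localization.Away (∏ l, (M l).det)

variable (M : Fin k → Matrix (Fin r) (Fin r) (MvPolynomial σ 𝕜))

theorem isUnit_algebraMap_det (l : Fin k) :
    IsUnit (algebraMap (MvPolynomial σ 𝕜) (CoordRing M) (M l).det) :=
  isUnit_of_dvd_unit (map_dvd _ (Finset.dvd_prod_of_mem (fun l => (M l).det) (Finset.mem_univ l)))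
    (IsLocalization.Away.algebraMap_isUnit (∏ l, (M l).det))

/-- The inverse of the determinant of `M l`. -/
noncomputable def invDet (l : Fin k) : CoordRing M := ↑(isUnit_algebraMap_det M l).unit⁻¹

theorem invDet_mul (l : Fin k) :
    invDet M l * algebraMap (MvPolynomial σ 𝕜) (CoordRing M) (M l).det = 1 :=
  (isUnit_algebraMap_det M l).val_inv_mul

/-- The matrices `M l`, normalized to determinant one by scaling their `i`-th rows. -/
noncomputable def normalized (i : Fin r) (l : Fin k) :
    Matrix.SpecialLinearGroup (Fin r) (CoordRing M) :=
  rowScale i ((M l).map (algebraMap (MvPolynomial σ 𝕜) (CoordRing M))) (invDet M l) (by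
    rw [← RingHom.mapMatrix_apply, ← RingHom.map_det, invDet_mul])

theorem normalized_apply (i : Fin r) (l : Fin k) (a b : Fin r) :
    (normalized M i l).1 a b = (if a = i then invDet M l else 1) *
      algebraMap (MvPolynomial σ 𝕜) (CoordRing M) (M l a b) := by
  simp only [normalized, rowScale, Matrix.updateRow_apply, Pi.smul_apply, Matrix.map_apply,
    smul_eq_mul]
  split_ifs with h
  · rw [h]
  · rw [one_mul]

/-- The representation of the free group given by the normalized matrices. -/
noncomputable def genericRep (i : Fin r) :
    FreeGroup (Fin k) →* Matrix.SpecialLinearGroup (Fin r) (CoordRing M) :=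
  FreeGroup.lift (normalized M i)

theorem powers_prod_det_le (h : ∀ l, (M l).det ≠ 0) :
    Submonoid.powers (∏ l, (M l).det) ≤ nonZeroDivisors (MvPolynomial σ 𝕜) :=
  powers_le_nonZeroDivisors_of_noZeroDivisors (Finset.prod_ne_zero_iff.2 fun l _ => h l)

theorem isDomain_coordRing (h : ∀ l, (M l).det ≠ 0) : IsDomain (CoordRing M) :=
  IsLocalization.isDomain_localization (powers_prod_det_le M h)

theorem algebraMap_coordRing_injective (h : ∀ l, (M l).det ≠ 0) :
    Function.Injective (algebraMap (MvPolynomial σ 𝕜) (CoordRing M)) :=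
  IsLocalization.injective (CoordRing M) (powers_prod_det_le M h)

/-- At a point where all determinants are already one, the scaling factors specialize to one, so
normalization loses no such point. -/
theorem exists_algHom_normalized (i : Fin r) (x : σ → 𝕜)
    (hx : ∀ l, ((M l).map (MvPolynomial.eval x)).det = 1) :
    ∃ φ : CoordRing M →ₐ[𝕜] 𝕜, ∀ l,
      (normalized M i l).1.map φ = (M l).map (MvPolynomial.eval x) := by
  have hdet : ∀ l, MvPolynomial.eval x (M l).det = 1 := fun l => by
    rw [RingHom.map_det, RingHom.mapMatrix_apply, hx]
  let φ : CoordRing M →ₐ[𝕜] 𝕜 := IsLocalization.liftAlgHom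
    (M := Submonoid.powers (∏ l, (M l).det)) (f := MvPolynomial.aeval x) (by
      rintro ⟨_, n, rfl⟩
      simp [MvPolynomial.aeval_eq_eval, map_prod, hdet])
  have hφ : ∀ p, φ (algebraMap (MvPolynomial σ 𝕜) (CoordRing M) p) = MvPolynomial.eval x p := by
    intro p
    exact IsLocalization.lift_eq _ _
  have hinv : ∀ l, φ (invDet M l) = 1 := fun l => by
    have := congrArg φ (invDet_mul M l)
    rwa [map_mul, hφ, hdet, mul_one, map_one] at this
  refine ⟨φ, fun l => ?_⟩
  ext a b
  rw [Matrix.map_apply, normalized_apply, map_mul, hφ, Matrix.map_apply]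
  split_ifs
  · rw [hinv, one_mul]
  · rw [map_one, one_mul]

end Generic

/-! ### Conjugation, the determinant relation and Krylov matrices -/

section Conj

variable {Γ R : Type*} [CommRing R] [Group Γ] {r : ℕ}

/-- Conjugation of a representation by an invertible matrix. -/
def conjRep (g h : Matrix (Fin r) (Fin r) R) (hgh : g * h = 1)
    (ρ : Γ →* Matrix.SpecialLinearGroup (Fin r) R) :
    Γ →* Matrix.SpecialLinearGroup (Fin r) R where
  toFun x := ⟨h * (ρ x).1 * g, by
    rw [Matrix.det_mul, Matrix.det_mul, (ρ x).2, mul_one, ← Matrix.det_mul,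
      mul_eq_one_comm.1 hgh, Matrix.det_one]⟩
  map_one' := Subtype.ext (by
    change h * (ρ 1).1 * g = 1
    rw [map_one]
    change h * 1 * g = 1
    rw [mul_one, mul_eq_one_comm.1 hgh])
  map_mul' x y := Subtype.ext (by
    change h * (ρ (x * y)).1 * g = h * (ρ x).1 * g * (h * (ρ y).1 * g)
    rw [map_mul]
    change h * ((ρ x).1 * (ρ y).1) * g = _
    simp only [mul_assoc]
    rw [← mul_assoc g h, hgh, one_mul])

theorem coe_conjRep (g h : Matrix (Fin r) (Fin r) R) (hgh : g * h = 1)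
    (ρ : Γ →* Matrix.SpecialLinearGroup (Fin r) R) (x : Γ) :
    (conjRep g h hgh ρ x).1 = h * (ρ x).1 * g := rfl

theorem trace_conjRep (g h : Matrix (Fin r) (Fin r) R) (hgh : g * h = 1)
    (ρ : Γ →* Matrix.SpecialLinearGroup (Fin r) R) (x : Γ) :
    (conjRep g h hgh ρ x).1.trace = (ρ x).1.trace := by
  rw [coe_conjRep, Matrix.trace_mul_cycle, hgh, one_mul]

/-- The generators already define a representation into the group `SL_r(E)`, which takes care of
inverses. -/
theorem apply_mem_of_of_apply_mem {ι 𝕜 : Type*} [Field 𝕜] [Algebra 𝕜 R] (E : Subalgebra 𝕜 R)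
    (ρ : FreeGroup ι →* Matrix.SpecialLinearGroup (Fin r) R)
    (h : ∀ l a b, (ρ (FreeGroup.of l)).1 a b ∈ E) (w : FreeGroup ι) (a b : Fin r) :
    (ρ w).1 a b ∈ E := by
  let B : ι → Matrix.SpecialLinearGroup (Fin r) E := fun l =>
    ⟨Matrix.of fun a b => ⟨_, h l a b⟩, by
      apply Subtype.val_injective
      change E.val.toRingHom _ = _
      rw [RingHom.map_det]
      exact (ρ (FreeGroup.of l)).2⟩
  have hρ : ρ = (Matrix.SpecialLinearGroup.map E.val.toRingHom).comp (FreeGroup.lift B) := by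
    apply FreeGroup.ext_hom
    intro l
    rw [MonoidHom.comp_apply, FreeGroup.lift_apply_of]
    rfl
  rw [hρ]
  exact ((FreeGroup.lift B w).1 a b).2

end Conj

/-- If the entries in `Z` were independent, `det = 1` would be a polynomial identity in them.
Setting all of them to zero kills a full row or column, so the determinant would be zero. -/
theorem eRk_entries_lt {𝕜 K : Type*} [Field 𝕜] [Field K] [Algebra 𝕜 K] {r : ℕ}
    (B : Matrix.SpecialLinearGroup (Fin r) K) (Z : Finset (Fin r × Fin r))
    (hconst : ∀ a b, (a, b) ∉ Z → B.1 a b ∈ Set.range (algebraMap 𝕜 K))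
    (hline : (∃ a, ∀ b, (a, b) ∈ Z) ∨ ∃ b, ∀ a, (a, b) ∈ Z) :
    (AlgebraicIndependent.matroid 𝕜 K).eRk (Set.range fun p : Fin r × Fin r => B.1 p.1 p.2) <
      Z.card := by
  classical
  let e : Z → K := fun p => B.1 p.1.1 p.1.2
  have hsub : (Set.range fun p : Fin r × Fin r => B.1 p.1 p.2) ⊆
      (AlgebraicIndependent.matroid 𝕜 K).closure (Set.range e) := by
    rw [AlgebraicIndependent.matroid_closure_eq]
    rintro _ ⟨⟨a, b⟩, rfl⟩
    have : B.1 a b ∈ Algebra.adjoin 𝕜 (Set.range e) := by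
      by_cases h : (a, b) ∈ Z
      · exact Algebra.subset_adjoin ⟨⟨_, h⟩, rfl⟩
      · obtain ⟨x, hx⟩ := hconst a b h
        rw [← hx]
        exact Subalgebra.algebraMap_mem _ x
    exact isAlgebraic_algebraMap (⟨_, this⟩ : Algebra.adjoin 𝕜 (Set.range e))
  refine (((AlgebraicIndependent.matroid 𝕜 K).eRk_mono hsub).trans
    (Matroid.eRk_closure_eq _ _).le).trans_lt ?_
  have hcard : (Set.range e).encard ≤ Z.card := by
    rw [← Set.image_univ]
    refine (Set.encard_image_le _ _).trans ?_
    simp [Set.encard_univ, ENat.card_eq_coe_fintype_card]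
  by_contra! hcon
  have hle := (AlgebraicIndependent.matroid 𝕜 K).eRk_le_encard (Set.range e)
  have hind : (AlgebraicIndependent.matroid 𝕜 K).Indep (Set.range e) :=
    (Matroid.indep_iff_eRk_eq_encard_of_finite (Set.finite_range e)).2
      (le_antisymm hle (hcard.trans hcon))
  have hinj : Function.Injective e := by
    rw [← Set.injOn_univ]
    refine (Set.finite_univ).injOn_of_encard_image_eq ?_
    rw [Set.image_univ, Set.encard_univ, ENat.card_eq_coe_fintype_card, Fintype.card_coe]
    exact le_antisymm hcard (hcon.trans hle)
  have halg : AlgebraicIndependent 𝕜 e := by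
    rw [AlgebraicIndependent.matroid_indep_iff] at hind
    exact (algebraicIndependent_subtype_range hinj).1 hind
  choose! x hx using hconst
  let G : Matrix (Fin r) (Fin r) (MvPolynomial Z 𝕜) := Matrix.of fun a b =>
    if h : (a, b) ∈ Z then MvPolynomial.X ⟨(a, b), h⟩ else MvPolynomial.C (x a b)
  have hG : G.map (MvPolynomial.aeval e) = B.1 := by
    ext a b
    simp only [G, Matrix.map_apply, Matrix.of_apply]
    split_ifs with h
    · rw [MvPolynomial.aeval_X]
    · rw [MvPolynomial.aeval_C, hx a b h]
  have hdet : G.det = 1 := by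
    apply halg
    rw [AlgHom.map_det, AlgHom.mapMatrix_apply, hG, B.2, map_one]
  have h0 : (G.map (MvPolynomial.eval 0)).det = 1 := by
    rw [← RingHom.mapMatrix_apply, ← RingHom.map_det, hdet, map_one]
  rcases hline with ⟨a, ha⟩ | ⟨b, hb⟩
  · rw [Matrix.det_eq_zero_of_row_eq_zero a] at h0
    · exact zero_ne_one h0
    · intro b
      simp [G, ha b]
  · rw [Matrix.det_eq_zero_of_column_eq_zero b] at h0
    · exact zero_ne_one h0
    · intro a
      simp [G, hb a]

/-- The matrix with columns `e₀, A e₀, A² e₀, …`. -/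
def krylov {R : Type*} [CommRing R] {n : ℕ} (A : Matrix (Fin (n + 1)) (Fin (n + 1)) R) :
    Matrix (Fin (n + 1)) (Fin (n + 1)) R :=
  Matrix.of fun i j => (A ^ (j : ℕ)) i 0

theorem krylov_map {R S : Type*} [CommRing R] [CommRing S] (f : R →+* S) {n : ℕ}
    (A : Matrix (Fin (n + 1)) (Fin (n + 1)) R) : (krylov A).map f = krylov (A.map f) := by
  ext i j
  simp only [krylov, Matrix.map_apply, Matrix.of_apply]
  rw [← RingHom.mapMatrix_apply, ← map_pow]
  rfl

/-- The unipotent matrix with ones on the diagonal and just below it. -/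
def unipotentBlock (R : Type*) [CommRing R] (n : ℕ) : Matrix (Fin (n + 1)) (Fin (n + 1)) R :=
  Matrix.of fun i j => if i = j then 1 else if (i : ℕ) = j + 1 then 1 else 0

theorem unipotentBlock_apply (R : Type*) [CommRing R] (n : ℕ) (i j : Fin (n + 1)) :
    unipotentBlock R n i j = if i = j then 1 else if (i : ℕ) = j + 1 then 1 else 0 := rfl

theorem det_unipotentBlock (R : Type*) [CommRing R] (n : ℕ) : (unipotentBlock R n).det = 1 := by
  rw [Matrix.det_of_isLowerTriangular]
  · simp [unipotentBlock]
  · intro i j hij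
    have hij' : i < j := hij
    simp only [unipotentBlock, Matrix.of_apply]
    rw [if_neg hij'.ne, if_neg (by omega)]

theorem unipotentBlock_pow_apply (R : Type*) [CommRing R] (n j : ℕ) (i : Fin (n + 1)) :
    (unipotentBlock R n ^ j) i 0 = (j.choose i : R) := by
  induction j generalizing i with
  | zero =>
    rw [pow_zero, Matrix.one_apply]
    rcases Fin.eq_zero_or_eq_succ i with rfl | ⟨m, rfl⟩
    · simp
    · simp
  | succ j ih =>
    rw [pow_succ', Matrix.mul_apply]
    simp only [ih, unipotentBlock_apply]
    rcases Fin.eq_zero_or_eq_succ i with rfl | ⟨m, rfl⟩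
    · rw [Finset.sum_eq_single 0]
      · simp
      · intro b _ hb
        rw [if_neg hb.symm, if_neg (by simp), zero_mul]
      · simp
    · rw [Finset.sum_eq_add_of_mem (m.succ) (m.castSucc) (Finset.mem_univ _) (Finset.mem_univ _)
        (by simp [Fin.ext_iff])]
      · rw [if_pos rfl, if_neg (by simp [Fin.ext_iff]), if_pos (by simp)]
        simp [Nat.choose_succ_succ, add_comm]
      · intro b _ hb
        rw [if_neg hb.1.symm, if_neg (fun h => hb.2 (by
          simp only [Fin.val_succ, add_left_inj] at h
          exact Fin.ext h.symm)), zero_mul]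

/-- The columns are binomial coefficients, so the matrix is unitriangular in every characteristic.
It serves as the specialization at which a generic Krylov determinant is nonzero. -/
theorem det_krylov_unipotentBlock (R : Type*) [CommRing R] (n : ℕ) :
    (krylov (unipotentBlock R n)).det = 1 := by
  rw [Matrix.det_of_isUpperTriangular]
  · simp [krylov, unipotentBlock_pow_apply]
  · intro i j hij
    have hij' : j < i := hij
    simp only [krylov, Matrix.of_apply, unipotentBlock_pow_apply]
    rw [Nat.choose_eq_zero_of_lt hij', Nat.cast_zero]

/-- This shift of columns makes the conjugate of `A` by its Krylov matrix a companion matrix. -/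
theorem mul_krylov_apply {R : Type*} [CommRing R] {n : ℕ}
    (A : Matrix (Fin (n + 1)) (Fin (n + 1)) R) (i : Fin (n + 1)) (j : Fin n) :
    (A * krylov A) i j.castSucc = krylov A i j.succ := by
  simp only [krylov, Matrix.mul_apply, Matrix.of_apply, Fin.val_succ, Fin.val_castSucc, pow_succ']

theorem krylov_apply_zero {R : Type*} [CommRing R] {n : ℕ}
    (A : Matrix (Fin (n + 1)) (Fin (n + 1)) R) (i : Fin (n + 1)) :
    krylov A i 0 = (1 : Matrix (Fin (n + 1)) (Fin (n + 1)) R) i 0 := by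
  simp [krylov]

/-- Over an algebraically closed field, a representation can be conjugated so that a given group
element has `e₀` as an eigenvector. -/
theorem exists_conj_first_column {𝕜 Γ : Type*} [Field 𝕜] [IsAlgClosed 𝕜] [Group Γ] {n : ℕ}
    (ρ : Γ →* Matrix.SpecialLinearGroup (Fin (n + 1)) 𝕜) (x : Γ) :
    ∃ ρ' : Γ →* Matrix.SpecialLinearGroup (Fin (n + 1)) 𝕜, character ρ' = character ρ ∧
      ∀ i, i ≠ 0 → (ρ' x).1 i 0 = 0 := by
  obtain ⟨c, hc⟩ := Module.End.exists_eigenvalue (Matrix.toLin' (ρ x).1)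
  obtain ⟨v, hv⟩ := hc.exists_hasEigenvector
  obtain ⟨i₀, hi₀⟩ := Function.ne_iff.1 hv.2
  -- The identity with column `i₀` replaced by `v` has determinant `v i₀ ≠ 0`; the swap then moves
  -- `v` to column zero.
  let g₀ : Matrix (Fin (n + 1)) (Fin (n + 1)) 𝕜 := Matrix.updateCol 1 i₀ v
  let g : Matrix (Fin (n + 1)) (Fin (n + 1)) 𝕜 := g₀.submatrix id (Equiv.swap 0 i₀)
  have hg : IsUnit g.det := by
    have h1 : g₀.det = v i₀ := by
      rw [← Matrix.cramer_apply, Matrix.cramer_one]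
      rfl
    rw [Matrix.det_permute', h1]
    exact (((Equiv.Perm.sign (Equiv.swap 0 i₀)).isUnit).map (Int.castRingHom 𝕜)).mul
      (isUnit_iff_ne_zero.2 hi₀)
  have hg0 : ∀ i, g i 0 = v i := fun i => by
    simp [g, g₀]
  have hgg := Matrix.mul_nonsing_inv g hg
  refine ⟨conjRep g g⁻¹ hgg ρ, ?_, fun i hi => ?_⟩
  · funext y
    exact trace_conjRep g g⁻¹ hgg ρ y
  · have hA : ∀ i, ((ρ x).1 * g) i 0 = c * g i 0 := by
      intro i
      have := congrFun hv.apply_eq_smul i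
      simpa [Matrix.mul_apply, Matrix.mulVec, dotProduct, hg0] using this
    rw [coe_conjRep, Matrix.mul_assoc, Matrix.mul_apply]
    simp only [hA, mul_left_comm _ c]
    rw [← Finset.mul_sum, ← Matrix.mul_apply, Matrix.nonsing_inv_mul g hg, Matrix.one_apply_ne hi,
      mul_zero]

/-! ### The upper bound -/

section Upper

variable (𝕜 : Type*) [Field 𝕜] (k n : ℕ)

/-- Generic matrices; the first column of the second one is a multiple of `e₀`. -/
noncomputable def genericMatrix (l : Fin k) : Matrix (Fin (n + 1)) (Fin (n + 1))
    (MvPolynomial (Fin k × Fin (n + 1) × Fin (n + 1)) 𝕜) :=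
  Matrix.of fun i j => if (l : ℕ) = 1 ∧ i ≠ 0 ∧ j = 0 then 0 else MvPolynomial.X (l, i, j)

variable {𝕜 k n}

theorem genericMatrix_map_eval (B : Fin k → Matrix (Fin (n + 1)) (Fin (n + 1)) 𝕜)
    (hB : ∀ l : Fin k, (l : ℕ) = 1 → ∀ i, i ≠ 0 → B l i 0 = 0) (l : Fin k) :
    (genericMatrix 𝕜 k n l).map (MvPolynomial.eval fun p => B p.1 p.2.1 p.2.2) = B l := by
  ext i j
  simp only [genericMatrix, Matrix.map_apply, Matrix.of_apply]
  split_ifs with h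
  · obtain ⟨h1, h2, rfl⟩ := h
    rw [map_zero, hB l h1 i h2]
  · rw [MvPolynomial.eval_X]

theorem det_genericMatrix_ne_zero (l : Fin k) : (genericMatrix 𝕜 k n l).det ≠ 0 := by
  intro h
  have h1 := genericMatrix_map_eval (k := k) (n := n) (fun _ => (1 : Matrix _ _ 𝕜))
    (fun _ _ i hi => Matrix.one_apply_ne hi) l
  have h2 := congrArg Matrix.det h1
  rw [← RingHom.mapMatrix_apply, ← RingHom.map_det, h, map_zero, Matrix.det_one] at h2
  exact zero_ne_one h2

/-- The bound for the number of parameters of the `l`-th matrix of a normal form. -/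
def paramCount (n : ℕ) : ℕ → ℕ
  | 0 => n
  | 1 => (n + 1) * n
  | _ => (n + 1) ^ 2 - 1

theorem sum_paramCount (n m : ℕ) :
    ∑ l ∈ Finset.range (m + 2), paramCount n l = ((n + 1) ^ 2 - 1) * (m + 1) := by
  induction m with
  | zero =>
    simp only [Finset.sum_range_succ, Finset.range_zero, Finset.sum_empty, paramCount]
    rw [show (n + 1) ^ 2 = (n + (n + 1) * n) + 1 by ring]
    simp
  | succ m ih =>
    rw [show m + 1 + 2 = (m + 2) + 1 by rfl, Finset.sum_range_succ, ih]
    simp only [paramCount]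
    ring

/-- The zeros imposed on the second generic matrix cost no characters, since conjugation can make
`e₀` an eigenvector of it. -/
theorem exists_algHom_character [IsAlgClosed 𝕜]
    (χ : CharacterVariety 𝕜 (FreeGroup (Fin k)) (n + 1)) :
    ∃ φ : CoordRing (genericMatrix 𝕜 k n) →ₐ[𝕜] 𝕜,
      χ.1 = fun g => φ (genericRep (genericMatrix 𝕜 k n) 0 g).1.trace := by
  obtain ⟨ρ, hρ, hB⟩ : ∃ ρ : FreeGroup (Fin k) →* Matrix.SpecialLinearGroup (Fin (n + 1)) 𝕜,
      character ρ = χ.1 ∧ ∀ l : Fin k, (l : ℕ) = 1 → ∀ i, i ≠ 0 →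
        (ρ (FreeGroup.of l)).1 i 0 = 0 := by
    obtain ⟨ρ, hρ⟩ := χ.2
    by_cases hk : 1 < k
    · obtain ⟨ρ', hρ', h⟩ := exists_conj_first_column ρ (FreeGroup.of ⟨1, hk⟩)
      refine ⟨ρ', hρ'.trans hρ, fun l hl => ?_⟩
      obtain rfl : l = ⟨1, hk⟩ := Fin.ext hl
      exact h
    · exact ⟨ρ, hρ, fun l hl => absurd l.2 (by omega)⟩
  obtain ⟨φ, hφ⟩ := exists_algHom_normalized (genericMatrix 𝕜 k n) 0
    (fun p => (ρ (FreeGroup.of p.1)).1 p.2.1 p.2.2) (fun l => by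
      rw [genericMatrix_map_eval (fun l => (ρ (FreeGroup.of l)).1) hB]
      exact (ρ (FreeGroup.of l)).2)
  refine ⟨φ, ?_⟩
  have hφρ : (Matrix.SpecialLinearGroup.map φ.toRingHom).comp
      (genericRep (genericMatrix 𝕜 k n) 0) = ρ := by
    apply FreeGroup.ext_hom
    intro l
    rw [MonoidHom.comp_apply, genericRep, FreeGroup.lift_apply_of]
    apply Subtype.ext
    exact (hφ l).trans (genericMatrix_map_eval (fun l => (ρ (FreeGroup.of l)).1) hB l)
  rw [← hρ, ← hφρ]
  funext g
  exact (AddMonoidHom.map_trace φ.toRingHom.toAddMonoidHom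
    (genericRep (genericMatrix 𝕜 k n) 0 g).1).symm

/-- Specialize the `l`-th matrix to `unipotentBlock` and all others to the identity; `l ≠ 1` because
the second matrix has `e₀` as an eigenvector. -/
theorem det_krylov_normalized_ne_zero (l : Fin k) (hl : (l : ℕ) ≠ 1) :
    (krylov (normalized (genericMatrix 𝕜 k n) 0 l).1).det ≠ 0 := by
  classical
  intro h
  let B : Fin k → Matrix (Fin (n + 1)) (Fin (n + 1)) 𝕜 := fun m =>
    if m = l then unipotentBlock 𝕜 n else 1
  have hB : ∀ m : Fin k, (m : ℕ) = 1 → ∀ i, i ≠ 0 → B m i 0 = 0 := by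
    intro m hm i hi
    have : m ≠ l := by rintro rfl; exact hl hm
    simp only [B, if_neg this, Matrix.one_apply_ne hi]
  obtain ⟨φ, hφ⟩ := exists_algHom_normalized (genericMatrix 𝕜 k n) 0
    (fun p => B p.1 p.2.1 p.2.2) (fun m => by
      rw [genericMatrix_map_eval B hB]
      simp only [B]
      split_ifs
      · exact det_unipotentBlock 𝕜 n
      · exact Matrix.det_one)
  have h1 := congrArg φ h
  rw [map_zero, AlgHom.map_det, AlgHom.mapMatrix_apply] at h1
  have h2 := krylov_map φ.toRingHom (normalized (genericMatrix 𝕜 k n) 0 l).1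
  have h3 : ((normalized (genericMatrix 𝕜 k n) 0 l).1).map φ.toRingHom = unipotentBlock 𝕜 n :=
    (hφ l).trans ((genericMatrix_map_eval B hB l).trans (if_pos rfl))
  rw [h3] at h2
  have h4 := det_krylov_unipotentBlock 𝕜 n
  rw [← h2] at h4
  exact one_ne_zero (h4.symm.trans h1)

theorem eRk_iUnion_le {α ι : Type*} (M : Matroid α) (s : Finset ι) (f : ι → Set α) :
    M.eRk (⋃ i ∈ s, f i) ≤ ∑ i ∈ s, M.eRk (f i) := by
  classical
  induction s using Finset.induction_on with
  | empty => simp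
  | insert a s ha ih =>
    rw [Finset.set_biUnion_insert, Finset.sum_insert ha]
    exact (M.eRk_union_le_eRk_add_eRk _ _).trans (add_le_add le_rfl ih)

theorem topologicalKrullDim_characterVariety_le [IsAlgClosed 𝕜] (hk : 0 < k) :
    topologicalKrullDim (CharacterVariety 𝕜 (FreeGroup (Fin k)) (n + 1)) ≤
      ((∑ l ∈ Finset.range k, paramCount n l : ℕ) : WithBot ℕ∞) := by
  let M := genericMatrix 𝕜 k n
  let A := CoordRing M
  have : IsDomain A := isDomain_coordRing M det_genericMatrix_ne_zero
  let K := FractionRing A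
  let ι : A →ₐ[𝕜] K := IsScalarTower.toAlgHom 𝕜 A K
  have hι : Function.Injective ι := IsFractionRing.injective A K
  let ρ : FreeGroup (Fin k) →* Matrix.SpecialLinearGroup (Fin (n + 1)) K :=
    (Matrix.SpecialLinearGroup.map ι.toRingHom).comp (genericRep M 0)
  have hρof : ∀ l, (ρ (FreeGroup.of l)).1 = (normalized M 0 l).1.map ι := by
    intro l
    simp only [ρ, MonoidHom.comp_apply, genericRep, FreeGroup.lift_apply_of]
    rfl
  have hρtr : ∀ g, (ρ g).1.trace = ι (genericRep M 0 g).1.trace := fun g =>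
    (AddMonoidHom.map_trace ι.toRingHom.toAddMonoidHom (genericRep M 0 g).1).symm
  let X := krylov (ρ (FreeGroup.of ⟨0, hk⟩)).1
  have hX : IsUnit X.det := by
    rw [isUnit_iff_ne_zero]
    intro h
    have h1 := krylov_map ι.toRingHom (normalized M 0 ⟨0, hk⟩).1
    apply det_krylov_normalized_ne_zero (𝕜 := 𝕜) (n := n) (⟨0, hk⟩ : Fin k) (by simp)
    apply hι
    rw [map_zero, ← h, AlgHom.map_det, AlgHom.mapMatrix_apply]
    refine congrArg Matrix.det (h1.trans ?_)
    simp only [X, hρof]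
    rfl
  have hXX := Matrix.mul_nonsing_inv X hX
  have hXX' := Matrix.nonsing_inv_mul X hX
  let τ := conjRep X X⁻¹ hXX ρ
  refine topologicalKrullDim_le (fun g => (ρ g).1.trace) (fun p hp χ => ?_) ?_
  · obtain ⟨φ, hφ⟩ := exists_algHom_character χ
    rw [hφ]
    have h1 : MvPolynomial.aeval (fun g => (genericRep M 0 g).1.trace) p = 0 := by
      apply hι
      rw [MvPolynomial.comp_aeval_apply, map_zero, ← hp]
      simp only [hρtr]
    have h2 := congrArg φ h1
    rw [MvPolynomial.comp_aeval_apply, map_zero, MvPolynomial.aeval_eq_eval] at h2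
    exact h2
  · let ent : Fin k → Set K := fun l =>
      Set.range fun p : Fin (n + 1) × Fin (n + 1) => (τ (FreeGroup.of l)).1 p.1 p.2
    have hent : ∀ l : Fin k, (AlgebraicIndependent.matroid 𝕜 K).eRk (ent l) ≤
        (paramCount n l : ℕ∞) := by
      -- `Z` contains the positions that may be nonconstant; the determinant relation accounts for
      -- the extra one in its cardinality. The index `b + 1` is cyclic, but the companion form is
      -- used only for `b ≠ Fin.last n`.
      have key : ∀ (l : Fin k) (Z : Finset (Fin (n + 1) × Fin (n + 1))),
          Z.card = paramCount n l + 1 →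
          (∀ a b, (a, b) ∉ Z → (τ (FreeGroup.of l)).1 a b =
            (1 : Matrix (Fin (n + 1)) (Fin (n + 1)) K) a (b + 1) ∨
            (τ (FreeGroup.of l)).1 a b = 0) →
          ((∃ a, ∀ b, (a, b) ∈ Z) ∨ ∃ b, ∀ a, (a, b) ∈ Z) →
          (AlgebraicIndependent.matroid 𝕜 K).eRk (ent l) ≤ (paramCount n l : ℕ∞) := by
        intro l Z hcard hconst hline
        have h1 := eRk_entries_lt (𝕜 := 𝕜) (τ (FreeGroup.of l)) Z (fun a b hab => by
          rcases hconst a b hab with h | h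
          · rw [h, Matrix.one_apply]
            split_ifs
            · exact ⟨1, map_one _⟩
            · exact ⟨0, map_zero _⟩
          · exact ⟨0, by rw [h, map_zero]⟩) hline
        rw [hcard, Nat.cast_add, Nat.cast_one] at h1
        exact Order.le_of_lt_add_one h1
      intro l
      rcases l with ⟨_ | _ | m, hl⟩
      · refine key _ (Finset.univ ×ˢ {Fin.last n}) (by simp [paramCount]) (fun a b hab => ?_)
          (Or.inr ⟨Fin.last n, fun a => by simp⟩)
        left
        have hb : b ≠ Fin.last n := by simpa [eq_comm] using hab
        obtain ⟨j, rfl⟩ := Fin.exists_castSucc_eq.2 hb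
        rw [coe_conjRep, Matrix.mul_assoc, Matrix.mul_apply]
        simp only [X, mul_krylov_apply]
        rw [← Matrix.mul_apply, hXX', Fin.coeSucc_eq_succ]
      · refine key _ (Finset.univ.filter fun p => ¬ (p.1 ≠ 0 ∧ p.2 = 0)) ?_ (fun a b hab => ?_)
          (Or.inl ⟨0, fun b => by simp⟩)
        · have h1 : (Finset.univ.filter fun p : Fin (n + 1) × Fin (n + 1) => p.1 ≠ 0 ∧ p.2 = 0) =
              ({0} : Finset (Fin (n + 1)))ᶜ ×ˢ {0} := by
            ext ⟨a, b⟩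
            simp only [Finset.mem_filter, Finset.mem_univ, true_and, Finset.mem_product,
              Finset.mem_compl, Finset.mem_singleton, ne_eq]
          rw [Finset.filter_not, Finset.card_sdiff_of_subset (Finset.filter_subset _ _), h1]
          have h2 : (n + 1) * (n + 1) = ((n + 1) * n + 1) + n := by ring
          simp [Finset.card_compl, paramCount]
          omega
        · right
          have hab' : a ≠ 0 ∧ b = 0 := by simpa using hab
          obtain ⟨ha, rfl⟩ := hab'
          -- `X` fixes `e₀`, so `e₀` remains an eigenvector of the second matrix after conjugation.
          have hX0 : ∀ i, X i 0 = (1 : Matrix (Fin (n + 1)) (Fin (n + 1)) K) i 0 :=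
            krylov_apply_zero _
          have h0 : ∀ i, (ρ (FreeGroup.of ⟨1, hl⟩)).1 i 0 =
              (ρ (FreeGroup.of ⟨1, hl⟩)).1 0 0 * X i 0 := by
            intro i
            rw [hX0]
            by_cases hi : i = 0
            · rw [hi, Matrix.one_apply_eq, mul_one]
            · rw [Matrix.one_apply_ne hi, mul_zero, hρof, Matrix.map_apply, normalized_apply]
              have : M ⟨1, hl⟩ i 0 = 0 := if_pos ⟨rfl, hi, rfl⟩
              rw [this, map_zero, mul_zero, map_zero]
          have h1 : ∀ i, ((ρ (FreeGroup.of ⟨1, hl⟩)).1 * X) i 0 =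
              (ρ (FreeGroup.of ⟨1, hl⟩)).1 i 0 := by
            intro i
            simp only [Matrix.mul_apply, hX0]
            rw [← Matrix.mul_apply, Matrix.mul_one]
          rw [coe_conjRep, Matrix.mul_assoc, Matrix.mul_apply]
          rw [Finset.sum_congr rfl fun m _ => by
            rw [h1, h0, mul_left_comm]]
          rw [← Finset.mul_sum, ← Matrix.mul_apply, hXX', Matrix.one_apply_ne ha, mul_zero]
      · refine key _ Finset.univ ?_ (fun a b hab => absurd (Finset.mem_univ _) hab)
          (Or.inl ⟨0, fun b => Finset.mem_univ _⟩)
        simp only [Finset.card_univ, Fintype.card_prod, Fintype.card_fin, paramCount]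
        rw [← sq, Nat.sub_add_cancel (Nat.one_le_pow _ _ n.succ_pos)]
    have hsub : (Set.range fun g => (ρ g).1.trace) ⊆
        (AlgebraicIndependent.matroid 𝕜 K).closure (⋃ l ∈ Finset.univ, ent l) := by
      rw [AlgebraicIndependent.matroid_closure_eq]
      rintro _ ⟨g, rfl⟩
      have hmem : (ρ g).1.trace ∈ Algebra.adjoin 𝕜 (⋃ l ∈ Finset.univ, ent l) := by
        rw [← trace_conjRep X X⁻¹ hXX ρ g]
        refine Subalgebra.sum_mem _ fun a _ => apply_mem_of_of_apply_mem _ τ (fun l a b => ?_) g a a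
        refine Algebra.subset_adjoin (Set.mem_iUnion₂.2 ⟨l, Finset.mem_univ l, ⟨(a, b), rfl⟩⟩)
      exact isAlgebraic_algebraMap (⟨_, hmem⟩ : Algebra.adjoin 𝕜 (⋃ l ∈ Finset.univ, ent l))
    refine (((AlgebraicIndependent.matroid 𝕜 K).eRk_mono hsub).trans
      (Matroid.eRk_closure_eq _ _).le).trans ?_
    refine (eRk_iUnion_le _ _ _).trans ((Finset.sum_le_sum fun l _ => hent l).trans ?_)
    rw [Fin.sum_univ_eq_sum_range (fun l => (paramCount n l : ℕ∞)), ← Nat.cast_sum]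

end Upper

/-! ### Recovering matrix entries from traces -/

section TraceField

variable {K : Type*} [Field K] (L : Subfield K) {r : ℕ}

/-- The Hankel matrix of power sums is `Vᵀ V` for the Vandermonde matrix `V`, hence invertible over
`L`. Solving a linear system with it gives a monic `f` over `L` with `Vᵀ (f (t m))ₘ = 0`, so `f`
kills every `t m`. Unlike Newton's identities, this needs no division by integers. -/
theorem isAlgebraic_of_sum_pow_mem {t : Fin r → K} (ht : Function.Injective t)
    (h : ∀ m : ℕ, ∑ i, t i ^ m ∈ L) (i : Fin r) : IsAlgebraic L (t i) := by
  let p : ℕ → L := fun m => ⟨_, h m⟩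
  let V := Matrix.vandermonde t
  have hV : V.det ≠ 0 := Matrix.det_vandermonde_ne_zero_iff.2 ht
  let H : Matrix (Fin r) (Fin r) L := Matrix.of fun a b => p (a + b)
  have hHV : H.map L.subtype = V.transpose * V := by
    ext a b
    simp [H, p, V, Matrix.mul_apply, Matrix.vandermonde_apply, pow_add]
  have hH : IsUnit H.det := by
    rw [isUnit_iff_ne_zero]
    intro h0
    have h1 : (H.map L.subtype).det = 0 := by
      rw [← RingHom.mapMatrix_apply, ← RingHom.map_det, h0, map_zero]
    rw [hHV, Matrix.det_mul, Matrix.det_transpose] at h1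
    exact mul_self_ne_zero.2 hV h1
  let a : Fin r → L := H⁻¹.mulVec fun i : Fin r => - p (i + r)
  have ha : H.mulVec a = fun i : Fin r => - p (i + r) := by
    rw [Matrix.mulVec_mulVec, Matrix.mul_nonsing_inv H hH, Matrix.one_mulVec]
  let f : Polynomial L := Polynomial.X ^ r + ∑ j : Fin r, Polynomial.C (a j) * Polynomial.X ^ (j : ℕ)
  have hf : f.Monic := Polynomial.monic_X_pow_add (Polynomial.degree_sum_fin_lt a)
  have hy : V.transpose.mulVec (fun m => Polynomial.aeval (t m) f) = 0 := by
    funext i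
    have h1 := congrArg L.subtype (congrFun ha i)
    have h2 : ∀ m, t m ^ (i : ℕ) * Polynomial.aeval (t m) f =
        t m ^ ((i : ℕ) + r) + ∑ j : Fin r, (a j : K) * t m ^ ((i : ℕ) + j) := by
      intro m
      simp only [f, map_add, map_pow, Polynomial.aeval_X, map_sum, map_mul, Polynomial.aeval_C,
        mul_add, Finset.mul_sum, pow_add]
      congr 1
      refine Finset.sum_congr rfl fun j _ => ?_
      change _ * ((a j : K) * _) = _
      ring
    simp only [Matrix.mulVec, dotProduct, Matrix.transpose_apply, V, Matrix.vandermonde_apply, h2,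
      Pi.zero_apply, Finset.sum_add_distrib]
    rw [Finset.sum_comm]
    simp only [← Finset.mul_sum]
    simp only [Matrix.mulVec, dotProduct, H, Matrix.of_apply, map_sum, map_mul, map_neg] at h1
    change ∑ j : Fin r, (∑ m, t m ^ ((i : ℕ) + j)) * (a j : K) = - ∑ m, t m ^ ((i : ℕ) + r) at h1
    simp only [mul_comm (_ : K) (∑ m, _)]
    rw [h1, add_neg_cancel]
  have hy0 := Matrix.eq_zero_of_mulVec_eq_zero (by rwa [Matrix.det_transpose]) hy
  exact ⟨f, hf.ne_zero, congrFun hy0 i⟩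

variable {L} (B : Subalgebra L (Matrix (Fin r) (Fin r) K))

/-- The idempotent is a Lagrange basis polynomial, with coefficients in `L`, evaluated at the
diagonal matrix. -/
theorem single_mem_of_diagonal_mem {t : Fin r → K} (ht : Function.Injective t)
    (htL : ∀ i, t i ∈ L) (hD : Matrix.diagonal t ∈ B) (j : Fin r) :
    Matrix.single j j (1 : K) ∈ B := by
  let t' : Fin r → L := fun i => ⟨t i, htL i⟩
  have ht' : Function.Injective t' := fun a b h => ht (congrArg Subtype.val h)
  have h1 : Polynomial.aeval (Matrix.diagonal t) (Lagrange.basis Finset.univ t' j) =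
      Matrix.single j j (1 : K) := by
    have h2 := Polynomial.aeval_algHom_apply (Matrix.diagonalAlgHom (n := Fin r) L (α := K)) t
      (Lagrange.basis Finset.univ t' j)
    refine h2.trans ?_
    have h3 : Polynomial.aeval t (Lagrange.basis Finset.univ t' j) = Pi.single j 1 := by
      funext i
      have h4 := Polynomial.aeval_algHom_apply (Pi.evalAlgHom L (fun _ : Fin r => K) i) t
        (Lagrange.basis Finset.univ t' j)
      refine h4.symm.trans ?_
      change Polynomial.aeval (algebraMap L K (t' i)) _ = _
      rw [Polynomial.aeval_algebraMap_apply, Polynomial.coe_aeval_eq_eval]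
      by_cases hij : i = j
      · subst hij
        rw [Lagrange.eval_basis_self ht'.injOn (Finset.mem_univ _), Pi.single_eq_same, map_one]
      · rw [Lagrange.eval_basis_of_ne (Ne.symm hij) (Finset.mem_univ _), Pi.single_eq_of_ne hij,
          map_zero]
    rw [h3]
    exact Matrix.diagonal_single j 1
  rw [← h1]
  exact Algebra.adjoin_le (Set.singleton_subset_iff.2 hD) (Polynomial.aeval_mem_adjoin_singleton _ _)

variable {B}

theorem apply_mem_of_trace_mem (htr : ∀ X ∈ B, X.trace ∈ L)
    (hE : ∀ j, Matrix.single j j (1 : K) ∈ B) {X : Matrix (Fin r) (Fin r) K} (hX : X ∈ B)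
    (j : Fin r) : X j j ∈ L := by
  have := htr _ (B.mul_mem (hE j) hX)
  rwa [Matrix.trace_single_mul, one_smul] at this

/-- With `E` the diagonal idempotents, the `(o, o)` entry of `Q E_i X E_j R` is `Q o i * X i j * R j
o`. Here `Q o i = 1`, and `R j o` is a nonzero element of `L` by the same argument applied to `S E_j
R`. -/
theorem apply_mem_of_row_of_column (htr : ∀ X ∈ B, X.trace ∈ L)
    (hE : ∀ j, Matrix.single j j (1 : K) ∈ B) (o : Fin r)
    (hrow : ∀ j, ∃ Q ∈ B, Q o j = 1) (hcol : ∀ j, ∃ Q ∈ B, Q j o ≠ 0)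
    {X : Matrix (Fin r) (Fin r) K} (hX : X ∈ B) (i j : Fin r) : X i j ∈ L := by
  have hmul : ∀ {X Y : Matrix (Fin r) (Fin r) K}, X ∈ B → Y ∈ B → ∀ j,
      X * Matrix.single j j (1 : K) * Y ∈ B := fun hX hY j => B.mul_mem (B.mul_mem hX (hE j)) hY
  have happ : ∀ (X Y : Matrix (Fin r) (Fin r) K) (j a b : Fin r),
      (X * Matrix.single j j (1 : K) * Y : Matrix (Fin r) (Fin r) K) a b = X a j * Y j b := by
    intro X Y j a b
    rw [Matrix.mul_apply, Finset.sum_eq_single j]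
    · simp
    · intro c _ hc
      simp [Matrix.mul_single_apply_of_ne, hc]
    · simp
  obtain ⟨Q, hQ, hQ1⟩ := hrow i
  obtain ⟨R, hR, hR0⟩ := hcol j
  obtain ⟨S, hS, hS1⟩ := hrow j
  have h1 : R j o ∈ L := by
    have := apply_mem_of_trace_mem htr hE (hmul hS hR j) o
    rwa [happ, hS1, one_mul] at this
  have h2 := apply_mem_of_trace_mem htr hE (hmul (hmul hQ hX i) hR j) o
  rw [happ, happ, hQ1, one_mul] at h2
  have h3 := L.mul_mem h2 (L.inv_mem h1)
  rwa [mul_assoc, mul_inv_cancel₀ hR0, mul_one] at h3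

end TraceField

/-- The image of `ρ` is closed under products, so the algebra is its `L`-span, and the trace is
linear. -/
theorem trace_mem_of_mem_adjoin {K Γ : Type*} [Field K] [Group Γ] (L : Subfield K) {r : ℕ}
    (ρ : Γ →* Matrix.SpecialLinearGroup (Fin r) K) (h : ∀ g, (ρ g).1.trace ∈ L)
    {X : Matrix (Fin r) (Fin r) K} (hX : X ∈ Algebra.adjoin L (Set.range fun g => (ρ g).1)) :
    X.trace ∈ L := by
  let φ : Γ →* Matrix (Fin r) (Fin r) K :=
    { toFun := fun g => (ρ g).1
      map_one' := by rw [map_one]; rfl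
      map_mul' := fun a b => by rw [map_mul]; rfl }
  have hs : (Set.range fun g => (ρ g).1) = (MonoidHom.mrange φ : Set (Matrix (Fin r) (Fin r) K)) := rfl
  rw [hs, ← Subalgebra.mem_toSubmodule, Algebra.adjoin_eq_span, Submonoid.closure_eq] at hX
  induction hX using Submodule.span_induction with
  | mem x hx => obtain ⟨g, rfl⟩ := hx; exact h g
  | zero => rw [Matrix.trace_zero]; exact L.zero_mem
  | add x y _ _ hx hy => rw [Matrix.trace_add]; exact L.add_mem hx hy
  | smul a x _ hx => rw [Matrix.trace_smul]; exact L.mul_mem a.2 hx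

/-- The free entries of the `l`-th matrix of the slice: the first matrix is diagonal, the first row
of the second one is constant off the diagonal, and the last diagonal entry is always fixed. -/
def IsCoord (n l : ℕ) (i j : Fin (n + 1)) : Prop :=
  ¬ (i = Fin.last n ∧ j = Fin.last n) ∧ (l = 0 → i = j) ∧ (l = 1 → i = 0 → j = 0)

instance (n l : ℕ) (i j : Fin (n + 1)) : Decidable (IsCoord n l i j) :=
  inferInstanceAs (Decidable (_ ∧ _))

/-- The slice has exactly as many coordinates as the upper bound allows, matrix by matrix. -/
theorem card_isCoord (n l : ℕ) :
    (Finset.univ.filter fun p : Fin (n + 1) × Fin (n + 1) => IsCoord n l p.1 p.2).card =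
      paramCount n l := by
  rcases l with _ | _ | l
  · have : (Finset.univ.filter fun p : Fin (n + 1) × Fin (n + 1) => IsCoord n 0 p.1 p.2) =
        Finset.univ.image fun i : Fin n => (i.castSucc, i.castSucc) := by
      ext ⟨a, b⟩
      simp only [IsCoord, Finset.mem_filter, Finset.mem_univ, true_and, Finset.mem_image,
        Prod.mk.injEq]
      constructor
      · rintro ⟨h1, h2, -⟩
        obtain rfl := h2 trivial
        obtain ⟨i, hi⟩ := Fin.exists_castSucc_eq.2 fun h : a = Fin.last n => h1 ⟨h, h⟩
        exact ⟨i, hi, hi⟩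
      · rintro ⟨i, rfl, rfl⟩
        exact ⟨fun h => i.castSucc_ne_last h.1, fun _ => rfl, fun h => absurd h (by simp)⟩
    rw [this, Finset.card_image_of_injective]
    · simp [paramCount]
    · intro a b h
      exact Fin.castSucc_injective _ (Prod.mk.inj h).1
  · have : (Finset.univ.filter fun p : Fin (n + 1) × Fin (n + 1) => IsCoord n 1 p.1 p.2) =
        Finset.univ \ ({(Fin.last n, Fin.last n)} ∪ {0} ×ˢ ({0} : Finset (Fin (n + 1)))ᶜ) := by
      ext ⟨a, b⟩
      simp only [IsCoord, Finset.mem_filter, Finset.mem_univ, true_and, Finset.mem_sdiff,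
        Finset.mem_union, Finset.mem_singleton, Finset.mem_product, Finset.mem_compl,
        Prod.mk.injEq]
      tauto
    rw [zero_add, this, Finset.card_sdiff_of_subset (Finset.subset_univ _),
      Finset.card_union_of_disjoint]
    · have h2 : (n + 1) * (n + 1) = (n + 1) * n + (1 + n) := by ring
      simp [Finset.card_compl, paramCount]
      omega
    · rw [Finset.disjoint_singleton_left]
      simp only [Finset.mem_product, Finset.mem_singleton, Finset.mem_compl, not_and, not_not]
      exact id
  · have : (Finset.univ.filter fun p : Fin (n + 1) × Fin (n + 1) => IsCoord n (l + 2) p.1 p.2) =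
        Finset.univ.erase (Fin.last n, Fin.last n) := by
      ext ⟨a, b⟩
      simp [IsCoord]
    rw [this, Finset.card_erase_of_mem (Finset.mem_univ _)]
    simp [paramCount, sq]

/-- The coordinates of the slice. -/
abbrev SliceIndex (k n : ℕ) : Type :=
  {p : Fin k × Fin (n + 1) × Fin (n + 1) // IsCoord n p.1 p.2.1 p.2.2}

theorem card_sliceIndex (k n : ℕ) :
    Fintype.card (SliceIndex k n) = ∑ l ∈ Finset.range k, paramCount n l := by
  rw [Fintype.card_subtype, Finset.card_filter, Fintype.sum_prod_type,
    ← Fin.sum_univ_eq_sum_range (fun l => paramCount n l)]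
  refine Finset.sum_congr rfl fun l _ => ?_
  rw [← card_isCoord, Finset.card_filter]

theorem exists_subfield_mem_iff_isAlgebraic (R K : Type*) [CommRing R] [IsDomain R] [Field K]
    [Algebra R K] : ∃ L : Subfield K, (∀ x, x ∈ L ↔ IsAlgebraic R x) ∧
      ∀ x, IsAlgebraic L x → x ∈ L := by
  refine ⟨{ (Subalgebra.algebraicClosure R K).toSubring with
      inv_mem' := fun x hx => IsAlgebraic.inv hx }, fun x => Iff.rfl, fun x hx => ?_⟩
  have : IsAlgebraic (Subalgebra.algebraicClosure R K) x := hx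
  exact this.restrictScalars R

/-! ### The lower bound -/

section Lower

variable (𝕜 : Type*) [Field 𝕜] (k n : ℕ)

/-- The matrices of the slice, before normalization of their determinants. -/
noncomputable def sliceMatrix (l : Fin k) :
    Matrix (Fin (n + 1)) (Fin (n + 1)) (MvPolynomial (SliceIndex k n) 𝕜) :=
  Matrix.of fun i j => if h : IsCoord n l i j then MvPolynomial.X ⟨(l, i, j), h⟩
    else if (l : ℕ) = 0 ∧ i ≠ j then 0 else 1

variable {𝕜 k n}

theorem sliceMatrix_apply_coord {l : Fin k} {i j : Fin (n + 1)} (h : IsCoord n l i j) :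
    sliceMatrix 𝕜 k n l i j = MvPolynomial.X ⟨(l, i, j), h⟩ := dif_pos h

theorem sliceMatrix_apply_last (l : Fin k) :
    sliceMatrix 𝕜 k n l (Fin.last n) (Fin.last n) = 1 :=
  (dif_neg fun h => h.1 ⟨rfl, rfl⟩).trans (if_neg fun h => h.2 rfl)

theorem sliceMatrix_zero (l : Fin k) (hl : (l : ℕ) = 0) :
    sliceMatrix 𝕜 k n l = Matrix.diagonal fun i => sliceMatrix 𝕜 k n l i i := by
  ext1 i j
  by_cases hij : i = j
  · rw [hij, Matrix.diagonal_apply_eq]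
  · rw [Matrix.diagonal_apply_ne _ hij]
    exact (dif_neg fun h => hij (h.2.1 hl)).trans (if_pos ⟨hl, hij⟩)

theorem sliceMatrix_one_apply {l : Fin k} (hl : (l : ℕ) = 1) {j : Fin (n + 1)} (hj : j ≠ 0) :
    sliceMatrix 𝕜 k n l 0 j = 1 :=
  (dif_neg fun h => hj (h.2.2 hl rfl)).trans (if_neg fun h => by omega)

theorem det_sliceMatrix_ne_zero (l : Fin k) : (sliceMatrix 𝕜 k n l).det ≠ 0 := by
  intro h
  let B : Matrix (Fin (n + 1)) (Fin (n + 1)) 𝕜 := Matrix.of fun i j =>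
    if i = j ∨ (l : ℕ) = 1 ∧ i = 0 then 1 else 0
  have h1 : (sliceMatrix 𝕜 k n l).map (MvPolynomial.eval fun p => B p.1.2.1 p.1.2.2) = B := by
    ext i j
    rw [Matrix.map_apply]
    by_cases hc : IsCoord n l i j
    · rw [sliceMatrix_apply_coord hc, MvPolynomial.eval_X]
    · rw [sliceMatrix, Matrix.of_apply, dif_neg hc]
      simp only [B, Matrix.of_apply]
      by_cases hij : i = j
      · rw [if_neg fun h => h.2 hij, if_pos (Or.inl hij), map_one]
      · by_cases hl : (l : ℕ) = 0
        · rw [if_pos ⟨hl, hij⟩, if_neg (by omega), map_zero]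
        · have : (l : ℕ) = 1 ∧ i = 0 := by
            by_contra hcon
            refine hc ⟨fun h => hij (h.1.trans h.2.symm), fun h => absurd h hl, fun h1 h0 => ?_⟩
            exact absurd ⟨h1, h0⟩ hcon
          rw [if_neg fun h => hl h.1, if_pos (Or.inr this), map_one]
  have h2 : B.det = 1 := by
    rw [Matrix.det_of_isUpperTriangular]
    · simp [B]
    · intro i j hij
      have hij' : j < i := hij
      have hi : i ≠ 0 := (Fin.zero_le j |>.trans_lt hij').ne'
      simp [B, hij'.ne', hi]
  rw [← h1, ← RingHom.mapMatrix_apply, ← RingHom.map_det, h, map_zero] at h2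
  exact zero_ne_one h2

/-- Let `L` be the relative algebraic closure of the trace algebra in `K`. It contains the
eigenvalues of the first matrix, then the needed matrix entries, then the inverse determinants, and
so all coordinates. The last row is the one scaled, which preserves the ones in row zero of the
second matrix. -/
theorem isAlgebraic_slice (hk : 0 < k) [IsDomain (CoordRing (sliceMatrix 𝕜 k n))]
    (K : Type*) [Field K] [Algebra (CoordRing (sliceMatrix 𝕜 k n)) K]
    [IsFractionRing (CoordRing (sliceMatrix 𝕜 k n)) K] :
    Algebra.IsAlgebraic (Algebra.adjoin 𝕜 (Set.range fun g =>
      (genericRep (sliceMatrix 𝕜 k n) (Fin.last n) g).1.trace)) (CoordRing (sliceMatrix 𝕜 k n)) := by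
  let M := sliceMatrix 𝕜 k n
  let A := CoordRing M
  let S : Subalgebra 𝕜 A := Algebra.adjoin 𝕜 (Set.range fun g =>
    (genericRep M (Fin.last n) g).1.trace)
  obtain ⟨L, hL, hLalg⟩ := exists_subfield_mem_iff_isAlgebraic S K
  let ι : A →+* K := algebraMap A K
  have hι : Function.Injective ι := IsFractionRing.injective A K
  let ρ : FreeGroup (Fin k) →* Matrix.SpecialLinearGroup (Fin (n + 1)) K :=
    (Matrix.SpecialLinearGroup.map ι).comp (genericRep M (Fin.last n))
  have hρof : ∀ l a b, (ρ (FreeGroup.of l)).1 a b = ι ((normalized M (Fin.last n) l).1 a b) := by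
    intro l a b
    simp only [ρ, MonoidHom.comp_apply, genericRep, FreeGroup.lift_apply_of]
    rfl
  have hρtr : ∀ g, (ρ g).1.trace ∈ L := by
    intro g
    have : (ρ g).1.trace = algebraMap A K (genericRep M (Fin.last n) g).1.trace :=
      (AddMonoidHom.map_trace ι.toAddMonoidHom (genericRep M (Fin.last n) g).1).symm
    rw [this, hL]
    exact isAlgebraic_algebraMap (⟨_, Algebra.subset_adjoin ⟨g, rfl⟩⟩ : S)
  let B := Algebra.adjoin L (Set.range fun g => (ρ g).1)
  have hρB : ∀ g, (ρ g).1 ∈ B := fun g => Algebra.subset_adjoin ⟨g, rfl⟩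
  have htr : ∀ X ∈ B, X.trace ∈ L := fun X hX => trace_mem_of_mem_adjoin L ρ hρtr hX
  let z : Fin k := ⟨0, hk⟩
  have hinjP : Function.Injective (algebraMap (MvPolynomial (SliceIndex k n) 𝕜) A) :=
    algebraMap_coordRing_injective M det_sliceMatrix_ne_zero
  have hcoord : ∀ l i j, i ≠ Fin.last n →
      (normalized M (Fin.last n) l).1 i j = algebraMap _ A (M l i j) := by
    intro l i j hi
    rw [normalized_apply, if_neg hi, one_mul]
  let t : Fin (n + 1) → K := fun i => ι ((normalized M (Fin.last n) z).1 i i)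
  have hdiag : (ρ (FreeGroup.of z)).1 = Matrix.diagonal t := by
    ext i j
    rw [hρof]
    by_cases hij : i = j
    · rw [hij, Matrix.diagonal_apply_eq]
    · have : M z i j = 0 := by
        change sliceMatrix 𝕜 k n z i j = 0
        rw [sliceMatrix_zero z rfl, Matrix.diagonal_apply_ne _ hij]
      rw [Matrix.diagonal_apply_ne _ hij, normalized_apply, this, map_zero, mul_zero, map_zero]
  have hne : ∀ i, i ≠ Fin.last n →
      (normalized M (Fin.last n) z).1 i i ≠
        (normalized M (Fin.last n) z).1 (Fin.last n) (Fin.last n) := by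
    intro i hi h
    have hci : IsCoord n z i i := ⟨fun h => hi h.1, fun _ => rfl, fun _ h => h⟩
    rw [hcoord z i i hi, normalized_apply, if_pos rfl, show M z (Fin.last n) (Fin.last n) = 1 from
      sliceMatrix_apply_last z, map_one, mul_one] at h
    have h1 := invDet_mul M z
    rw [← h, ← map_mul] at h1
    -- Equality would make a variable times the determinant equal to one, which fails at the origin.
    have h2 := congrArg (MvPolynomial.eval 0) (hinjP (h1.trans (map_one _).symm))
    rw [map_mul, show M z i i = _ from sliceMatrix_apply_coord hci, MvPolynomial.eval_X, map_one,
      Pi.zero_apply, zero_mul] at h2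
    exact zero_ne_one h2
  have ht : Function.Injective t := by
    intro i j hij
    have h := hι hij
    by_contra hne'
    by_cases hi : i = Fin.last n
    · subst hi
      exact hne j (Ne.symm hne') h.symm
    by_cases hj : j = Fin.last n
    · subst hj
      exact hne i hi h
    have hci : IsCoord n z i i := ⟨fun h => hi h.1, fun _ => rfl, fun _ h => h⟩
    have hcj : IsCoord n z j j := ⟨fun h => hj h.1, fun _ => rfl, fun _ h => h⟩
    rw [hcoord z i i hi, hcoord z j j hj] at h
    have h1 := hinjP h
    rw [show M z i i = _ from sliceMatrix_apply_coord hci,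
      show M z j j = _ from sliceMatrix_apply_coord hcj] at h1
    have h2 := MvPolynomial.X_injective h1
    simp only [Subtype.mk.injEq, Prod.mk.injEq, true_and, and_self] at h2
    exact hne' h2
  have htL : ∀ i, t i ∈ L := by
    intro i
    -- The power sums of the eigenvalues are the traces of powers of the first generator.
    refine hLalg _ (isAlgebraic_of_sum_pow_mem L ht (fun m => ?_) i)
    have h1 := hρtr (FreeGroup.of z ^ m)
    have h2 : (ρ (FreeGroup.of z ^ m)).1 = Matrix.diagonal (t ^ m) := by
      rw [map_pow, ← Matrix.diagonal_pow, ← hdiag]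
      rfl
    rw [h2, Matrix.trace_diagonal] at h1
    exact h1
  have hE := single_mem_of_diagonal_mem B ht htL (hdiag ▸ hρB _)
  have hinv0 : ∀ l, ι (invDet M l) ≠ 0 := by
    intro l h
    have := invDet_mul M l
    rw [hι (h.trans (map_zero ι).symm), zero_mul] at this
    exact zero_ne_one this
  have h0 : ∀ {j : Fin (n + 1)}, j ≠ 0 → (0 : Fin (n + 1)) ≠ Fin.last n := fun {j} hj h =>
    hj (Fin.le_zero_iff.1 (h ▸ Fin.le_last j))
  have hentry : ∀ (l : Fin k) (i j : Fin (n + 1)), IsCoord n l i j ∨ i = Fin.last n ∧ j = Fin.last n →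
      (ρ (FreeGroup.of l)).1 i j ∈ L := by
    intro l i j hij
    by_cases hk2 : 1 < k
    · let u : Fin k := ⟨1, hk2⟩
      -- Row zero of the second matrix supplies the ones and its column zero the nonzero entries;
      -- the identity covers `j = 0`.
      refine apply_mem_of_row_of_column htr hE 0 (fun j => ?_) (fun j => ?_) (hρB _) i j
      · by_cases hj : j = 0
        · exact ⟨1, B.one_mem, by rw [hj, Matrix.one_apply_eq]⟩
        · refine ⟨_, hρB (FreeGroup.of u), ?_⟩
          rw [hρof, hcoord u 0 j (h0 hj), show M u 0 j = 1 from sliceMatrix_one_apply rfl hj,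
            map_one, map_one]
      · by_cases hj : j = 0
        · exact ⟨1, B.one_mem, by rw [hj, Matrix.one_apply_eq]; exact one_ne_zero⟩
        · have hc : IsCoord n u j 0 :=
            ⟨fun h => h0 hj h.2, fun h => absurd h one_ne_zero, fun _ h => absurd h hj⟩
          refine ⟨_, hρB (FreeGroup.of u), ?_⟩
          rw [hρof, normalized_apply, map_mul, show M u j 0 = _ from sliceMatrix_apply_coord hc]
          refine mul_ne_zero ?_ ?_
          · split_ifs
            · exact hinv0 u
            · rw [map_one]; exact one_ne_zero
          · rw [Ne, map_eq_zero_iff ι hι, map_eq_zero_iff _ hinjP]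
            exact MvPolynomial.X_ne_zero _
    · obtain rfl : l = z := Fin.ext (by have := l.2; change (l : ℕ) = 0; omega)
      have hij' : i = j := by
        rcases hij with h | ⟨rfl, rfl⟩
        · exact h.2.1 rfl
        · rfl
      rw [hij']
      exact apply_mem_of_trace_mem htr hE (hρB _) j
  -- The last diagonal entry is one before normalization, hence the inverse determinant afterwards.
  have hinv : ∀ l, ι (invDet M l) ∈ L := by
    intro l
    have := hentry l _ _ (Or.inr ⟨rfl, rfl⟩)
    rwa [hρof, normalized_apply, if_pos rfl, show M l (Fin.last n) (Fin.last n) = 1 from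
      sliceMatrix_apply_last l, map_one, mul_one] at this
  have hpoly : ∀ p : MvPolynomial (SliceIndex k n) 𝕜, ι (algebraMap _ A p) ∈ L := by
    intro p
    induction p using MvPolynomial.induction_on with
    | C a =>
      rw [← MvPolynomial.algebraMap_eq,
        ← IsScalarTower.algebraMap_apply 𝕜 (MvPolynomial (SliceIndex k n) 𝕜) A, hL]
      exact isAlgebraic_algebraMap (algebraMap 𝕜 S a)
    | add p q hp hq => rw [map_add, map_add]; exact L.add_mem hp hq
    | mul_X p v hp =>
      rw [map_mul, map_mul]
      refine L.mul_mem hp ?_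
      obtain ⟨⟨l, i, j⟩, hv⟩ := v
      have h1 := hentry l i j (Or.inl hv)
      rw [hρof, normalized_apply, map_mul, show M l i j = _ from sliceMatrix_apply_coord hv] at h1
      split_ifs at h1
      · have := L.mul_mem (L.inv_mem (hinv l)) h1
        rwa [inv_mul_cancel_left₀ (hinv0 l)] at this
      · rwa [map_one, one_mul] at h1
  refine ⟨fun a => ?_⟩
  have hinjK : Function.Injective (algebraMap A K) := hι
  refine (isAlgebraic_algebraMap_iff (R := S) hinjK).1 ?_
  obtain ⟨⟨p, s⟩, hps⟩ := IsLocalization.surj (Submonoid.powers (∏ l, (M l).det)) a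
  have h1 : ι a * ι (algebraMap _ A (s : MvPolynomial (SliceIndex k n) 𝕜)) = ι (algebraMap _ A p) := by
    rw [← map_mul, hps]
  have h2 : ι (algebraMap _ A (s : MvPolynomial (SliceIndex k n) 𝕜)) ≠ 0 := by
    intro h
    exact (IsLocalization.map_units A s).ne_zero (hι (h.trans (map_zero ι).symm))
  have h3 : ι a ∈ L := by
    rw [eq_div_of_mul_eq h2 h1]
    exact L.div_mem (hpoly _) (hpoly _)
  exact (hL _).1 h3

theorem le_topologicalKrullDim_characterVariety [IsAlgClosed 𝕜] (hk : 0 < k) :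
    ((∑ l ∈ Finset.range k, paramCount n l : ℕ) : WithBot ℕ∞) ≤
      topologicalKrullDim (CharacterVariety 𝕜 (FreeGroup (Fin k)) (n + 1)) := by
  let M := sliceMatrix 𝕜 k n
  have hdom : IsDomain (CoordRing M) := isDomain_coordRing M det_sliceMatrix_ne_zero
  have hft : Algebra.FiniteType 𝕜 (CoordRing M) :=
    Algebra.FiniteType.trans (S := MvPolynomial (SliceIndex k n) 𝕜) inferInstance inferInstance
  have hinjP : Function.Injective
      (IsScalarTower.toAlgHom 𝕜 (MvPolynomial (SliceIndex k n) 𝕜) (CoordRing M)) :=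
    algebraMap_coordRing_injective M det_sliceMatrix_ne_zero
  have e := Fintype.equivFinOfCardEq (card_sliceIndex k n)
  have halg := isAlgebraic_slice (𝕜 := 𝕜) (k := k) (n := n) hk (FractionRing (CoordRing M))
  have hX := ((MvPolynomial.algebraicIndependent_X (SliceIndex k n) 𝕜).map' hinjP).comp e.symm
    e.symm.injective
  refine le_topologicalKrullDim (fun g => (genericRep M (Fin.last n) g).1.trace) (fun φ => ?_) hX
  refine ⟨⟨_, (Matrix.SpecialLinearGroup.map φ.toRingHom).comp (genericRep M (Fin.last n)),
    rfl⟩, ?_⟩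
  funext g
  exact (AddMonoidHom.map_trace φ.toRingHom.toAddMonoidHom (genericRep M (Fin.last n) g).1).symm

end Lower

end CharVar

theorem mainTheorem9 (𝕜 : Type*) [Field 𝕜] [IsAlgClosed 𝕜] (r : ℕ) (hr : 1 ≤ r) :
    (∀ k : ℕ, 2 ≤ k →
      topologicalKrullDim (CharVar.CharacterVariety 𝕜 (FreeGroup (Fin k)) r) =
        (((r ^ 2 - 1) * (k - 1) : ℕ) : WithBot ℕ∞)) ∧
    topologicalKrullDim (CharVar.CharacterVariety 𝕜 (FreeGroup (Fin 1)) r) =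
      ((r - 1 : ℕ) : WithBot ℕ∞) := by
  obtain ⟨n, rfl⟩ : ∃ n, r = n + 1 := ⟨r - 1, by omega⟩
  have key : ∀ k, 0 < k →
      topologicalKrullDim (CharVar.CharacterVariety 𝕜 (FreeGroup (Fin k)) (n + 1)) =
        ((∑ l ∈ Finset.range k, CharVar.paramCount n l : ℕ) : WithBot ℕ∞) := fun k hk =>
    le_antisymm (CharVar.topologicalKrullDim_characterVariety_le hk)
      (CharVar.le_topologicalKrullDim_characterVariety hk)
  refine ⟨fun k hk => ?_, ?_⟩
  · obtain ⟨m, rfl⟩ : ∃ m, k = m + 2 := ⟨k - 2, by omega⟩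
    rw [key _ (by omega), CharVar.sum_paramCount]
    rfl
  · rw [key 1 one_pos, Finset.sum_range_one]
    rfl
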